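/- **Conventions.** For a simplicial group $G$, the classifying space $BG$ is the simplicial set with $(BG)_n=G_{n-1}\times\dots\times G_0$, whose elements are written $[g_{n-1}|\dots|g_0]$, and with structure maps $$\partial_0[g_{n-1}|\dots|g_0]=[g_{n-2}|\dots|g_0],\qquad \partial_n[g_{n-1}|\dots|g_0]=[\partial_{n-1}g_{n-1}|\dots|\partial_1g_1],$$ $$\partial_i[g_{n-1}|\dots|g_0]=[\partial_{i-1}g_{n-1}|\dots|\partial_1g_{n-i+1}|\partial_0g_{n-i}\,g_{n-i-1}|g_{n-i-2}|\dots|g_0]\quad(1\le i\le n-1),$$ $$s_i[g_{n-1}|\dots|g_0]=[s_{i-1}g_{n-1}|\dots|s_0g_{n-i}|1|g_{n-i-1}|\dots|g_0]\quad(0\le i\le n).$$ For a reduced simplicial set $X$, the Kan loop group $\Omega X$ is the simplicial group in which $(\Omega X)_n$ is the free group on symbols $[x]$, $x\in X_{n+1}$, modulo $[s_0x]=1$ for $x\in X_n$, with $\partial_0[x]=[\partial_0x]^{-1}[\partial_1x]$, $\partial_i[x]=[\partial_{i+1}x]$ for $i\ge1$, and $s_i[x]=[s_{i+1}x]$. A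 twisting function $\tau\colon B_n\to H_{n-1}$ ($n\ge1$) from a simplicial set $B$ to a simplicial group $H$ satisfies $\partial_0\tau(b)=\tau(\partial_0b)^{-1}\tau(\partial_1b)$, $\partial_i\tau(b)=\tau(\partial_{i+1}b)$ for $i\ge1$, $s_i\tau(b)=\tau(s_{i+1}b)$ and $\tau(s_0b)=1$; an example is $\tau^X\colon x\mapsto[x]$ from $X$ to $\Omega X$. If $H$ acts on a simplicial set $F$ from the left, the twisted Cartesian product $F\times_\tau B$ has $n$-simplices $F_n\times B_n$ and the structure maps of $F\times B$, except that $\partial_0(f,b)=(\tau(b)\,\partial_0f,\partial_0b)$. A map $E\to B$ is a fibre bundle with fibre $F$ and structure group $H$ if $E$ is isomorphic over $B$ to some $F\times_\tau B$. **Theorem.** Let $1\to K\xrightarrow{\iota}G\xrightarrow{\pi}L\to1$ be a short exact sequence of simplicial groups, where $K$ is regarded as a subgroup of $G$. A *normalized pseudo-cross section* is a family of maps $\sigma\colon L_n\to G_n$ ($n\ge0$) with $\pi\sigma=\mathrm{id}$, $\partial_i\sigma=\sigma\partial_i$ for $1\le i\le n$, $s_i\sigma=\sigma s_i$ for $0\le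 i\le n$, and $\sigma(1)=1$. 1. A normalized pseudo-cross section exists. 2. Let $\sigma$ be any normalized pseudo-cross section. For $l_j\in L_j$ set $$l_{(a,q)}=\partial_0^{a-1-q}l_{a-1}\,\partial_0^{a-2-q}l_{a-2}\cdots\partial_0l_{q+1}\,l_q\in L_q\quad(q<a),\qquad l_{(q,q)}=1\in L_q.$$ Then there is an action of the simplicial group $\Omega BL$ on the simplicial set $BK$ such that for all $n\ge 0$, all $[l_n|\dots|l_0]\in(BL)_{n+1}$, representing a generator of $(\Omega BL)_n$, and all $[k_{n-1}|\dots|k_0]\in(BK)_n$, the $i$-th entry ($0\le i\le n-1$) of $[l_n|\dots|l_0]\cdot[k_{n-1}|\dots|k_0]$ is $$\partial_0\bigl(\sigma(l_{(n,i+1)})\bigr)\,\partial_0\bigl(\sigma(l_{(n+1,i+1)})\bigr)^{-1}\,k_i\,\sigma(l_{(n+1,i)})\,\sigma(l_{(n,i)})^{-1}.$$ Form $BK\times_{\tau^{BL}}BL$ with this action. Write $(k,l)\in K_i\times L_i$ for the element $k\,\sigma(l)\in G_i$; every element of $G_i$ is uniquely of this form. Then the map $$\Psi\colon BG\to BK\times_{\tau^{BL}}BL,\qquad[(k_{n-1},l_{n-1})|\dots|(k_0,l_0)]\mapsto\bigl([k'_{n-1}|\dots|k'_0],[l_{n-1}|\dots|l_0]\bigr),$$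 $$k'_i=\partial_0\bigl(\sigma(l_{(n,i+1)})\bigr)\,k_i\,\sigma(l_i)\,\sigma(l_{(n,i)})^{-1},$$ is an isomorphism of simplicial sets. Its composition with the projection to $BL$ is $B\pi\colon BG\to BL$. 3. Hence $B\pi\colon BG\to BL$ is a fibre bundle with fibre $BK$, base $BL$ and structure group the Kan loop group $\Omega BL$. -/

import Mathlib

universe u

open CategoryTheory Opposite
open scoped Simplicial

namespace SimplicialBundle

/-! Simplicial groups are simplicial objects `SimplicialObject GrpCat`, spaces are
simplicial sets `SSet`, both from Mathlib. -/

/-! ### Order maps on simplices -/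

/-- `0 ↦ 0`, `i + 1 ↦ α i + 1`: the map `α` extended by a new initial vertex. -/
def conePlus {a b : SimplexCategory} (α : a ⟶ b) : ⦋a.len + 1⦌ ⟶ ⦋b.len + 1⦌ :=
  SimplexCategory.Hom.mk
    { toFun := fun k ↦ Fin.cases (0 : Fin (b.len + 2)) (fun i ↦ (α.toOrderHom i).succ) k
      monotone' := by
        intro x y h
        induction x using Fin.cases with
        | zero => exact Fin.zero_le _
        | succ x =>
          induction y using Fin.cases with
          | zero => exact absurd h (by simp)
          | succ y => simpa using α.toOrderHom.monotone (by simpa using h) }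

/-- `0 ↦ 1`, `i + 1 ↦ α i + 1`. -/
def coneOne {a b : SimplexCategory} (α : a ⟶ b) : ⦋a.len + 1⦌ ⟶ ⦋b.len + 1⦌ :=
  SimplexCategory.Hom.mk
    { toFun := fun k ↦ Fin.cases (1 : Fin (b.len + 2)) (fun i ↦ (α.toOrderHom i).succ) k
      monotone' := by
        intro x y h
        induction x using Fin.cases with
        | zero =>
          induction y using Fin.cases with
          | zero => exact le_rfl
          | succ y => simp [Fin.le_def]
        | succ x =>
          induction y using Fin.cases with
          | zero => exact absurd h (by simp)
          | succ y => simpa using α.toOrderHom.monotone (by simpa using h) }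

/-- `0 ↦ 0`, `i + 1 ↦ α i`. -/
def coneZero {a b : SimplexCategory} (α : a ⟶ b) : ⦋a.len + 1⦌ ⟶ b :=
  SimplexCategory.Hom.mk
    { toFun := fun k ↦ Fin.cases (0 : Fin (b.len + 1)) (fun i ↦ α.toOrderHom i) k
      monotone' := by
        intro x y h
        induction x using Fin.cases with
        | zero => exact Fin.zero_le _
        | succ x =>
          induction y using Fin.cases with
          | zero => exact absurd h (by simp)
          | succ y => simpa using α.toOrderHom.monotone (by simpa using h) }

/-- Two morphisms agree if they agree on vertices. -/
theorem hom_ext_fin {a b : SimplexCategory} {f g : a ⟶ b}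
    (h : ∀ k : Fin (a.len + 1), f.toOrderHom k = g.toOrderHom k) : f = g := by
  apply SimplexCategory.Hom.ext
  ext k
  rw [h k]

@[simp] theorem conePlus_zero {a b : SimplexCategory} (α : a ⟶ b) :
    (conePlus α).toOrderHom 0 = (0 : Fin (b.len + 2)) := rfl
@[simp] theorem conePlus_succ {a b : SimplexCategory} (α : a ⟶ b) (i : Fin (a.len + 1)) :
    (conePlus α).toOrderHom i.succ = (α.toOrderHom i).succ := rfl
@[simp] theorem coneOne_zero {a b : SimplexCategory} (α : a ⟶ b) :
    (coneOne α).toOrderHom 0 = (1 : Fin (b.len + 2)) := rfl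
@[simp] theorem coneOne_succ {a b : SimplexCategory} (α : a ⟶ b) (i : Fin (a.len + 1)) :
    (coneOne α).toOrderHom i.succ = (α.toOrderHom i).succ := rfl
@[simp] theorem coneZero_zero {a b : SimplexCategory} (α : a ⟶ b) :
    (coneZero α).toOrderHom 0 = (0 : Fin (b.len + 1)) := rfl
@[simp] theorem coneZero_succ {a b : SimplexCategory} (α : a ⟶ b) (i : Fin (a.len + 1)) :
    (coneZero α).toOrderHom i.succ = α.toOrderHom i := rfl

theorem hom_ext_succ {n : ℕ} {b : SimplexCategory} {f g : ⦋n + 1⦌ ⟶ b}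
    (h0 : f.toOrderHom (0 : Fin (n + 2)) = g.toOrderHom (0 : Fin (n + 2)))
    (hs : ∀ k : Fin (n + 1), f.toOrderHom k.succ = g.toOrderHom k.succ) : f = g := by
  apply hom_ext_fin
  intro k
  induction k using Fin.cases with
  | zero => exact h0
  | succ k => exact hs k

theorem conePlus_comp {a b c : SimplexCategory} (β : a ⟶ b) (α : b ⟶ c) :
    conePlus (β ≫ α) = conePlus β ≫ conePlus α := by
  apply hom_ext_succ
  · rfl
  · intro k; rfl

theorem conePlus_id (a : SimplexCategory) : conePlus (𝟙 a) = 𝟙 _ := by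
  apply hom_ext_succ
  · rfl
  · intro k; rfl

theorem coneOne_id (a : SimplexCategory) :
    coneOne (𝟙 a) = SimplexCategory.σ 0 ≫ SimplexCategory.δ 0 := by
  apply hom_ext_succ
  · rfl
  · intro k; rfl

theorem coneOne_comp {a b c : SimplexCategory} (β : a ⟶ b) (α : b ⟶ c) :
    coneOne (β ≫ α) = conePlus β ≫ coneOne α := by
  apply hom_ext_succ
  · rfl
  · intro k; rfl

theorem coneOne_comp' {a b c : SimplexCategory} (β : a ⟶ b) (α : b ⟶ c) :
    coneOne β ≫ conePlus α = coneOne β ≫ coneOne α := by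
  apply hom_ext_succ
  · rfl
  · intro k; rfl

theorem σ_zero_zero (n : ℕ) :
    (SimplexCategory.σ (0 : Fin (n + 1))).toOrderHom (0 : Fin (n + 2)) = (0 : Fin (n + 1)) := rfl

theorem σ_zero_succ (n : ℕ) (i : Fin (n + 1)) :
    (SimplexCategory.σ (0 : Fin (n + 1))).toOrderHom i.succ = i := by
  change Fin.predAbove 0 i.succ = i
  simp

theorem coneZero_eq {a b : SimplexCategory} (α : a ⟶ b) :
    coneZero α = conePlus α ≫ SimplexCategory.σ (0 : Fin (b.len + 1)) := by
  apply hom_ext_succ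
  · rfl
  · intro k
    exact (σ_zero_succ b.len (α.toOrderHom k)).symm

theorem coneOne_σ_zero {a b : SimplexCategory} (α : a ⟶ b) :
    coneOne α ≫ SimplexCategory.σ (0 : Fin (b.len + 1)) =
      conePlus α ≫ SimplexCategory.σ (0 : Fin (b.len + 1)) := by
  apply hom_ext_succ
  · exact σ_zero_succ b.len 0
  · intro k; rfl

theorem coneZero_δ_zero (n : ℕ) : coneZero (SimplexCategory.δ (0 : Fin (n + 2))) = 𝟙 ⦋n + 1⦌ := by
  apply hom_ext_succ
  · rfl
  · intro k; rfl

theorem coneZero_of_zero {a b : SimplexCategory} (α : a ⟶ b)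
    (h : α.toOrderHom 0 = 0) : coneZero α = SimplexCategory.σ (0 : Fin (a.len + 1)) ≫ α := by
  apply hom_ext_succ
  · exact h.symm
  · intro k
    exact congrArg α.toOrderHom (σ_zero_succ a.len k).symm

theorem coneOne_of_zero {a b : SimplexCategory} (α : a ⟶ b)
    (h : α.toOrderHom 0 = 0) :
    coneOne α = SimplexCategory.σ (0 : Fin (a.len + 1)) ≫ α ≫
      SimplexCategory.δ (0 : Fin (b.len + 2)) := by
  apply hom_ext_succ
  · change (1 : Fin (b.len + 2)) = (α.toOrderHom 0).succ
    rw [h]; rfl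
  · intro k
    exact congrArg (fun i ↦ (α.toOrderHom i).succ) (σ_zero_succ a.len k).symm

theorem coneOne_δ_zero (n : ℕ) :
    coneOne (SimplexCategory.δ (0 : Fin (n + 2))) = SimplexCategory.δ (0 : Fin (n + 3)) := by
  apply hom_ext_succ
  · rfl
  · intro k; rfl

theorem conePlus_δ (n : ℕ) (i : Fin (n + 2)) :
    conePlus (SimplexCategory.δ i) = SimplexCategory.δ i.succ := by
  apply hom_ext_succ
  · exact (Fin.succ_succAbove_zero i).symm
  · intro k
    exact (Fin.succ_succAbove_succ i k).symm

theorem conePlus_σ (n : ℕ) (i : Fin (n + 1)) :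
    conePlus (SimplexCategory.σ i) = SimplexCategory.σ i.succ := by
  apply hom_ext_succ
  · exact (Fin.predAbove_right_zero (i := i.succ)).symm
  · intro k
    exact (Fin.succ_predAbove_succ i k).symm

theorem δ_succ_zero (n : ℕ) (i : Fin (n + 1)) :
    (SimplexCategory.δ i.succ).toOrderHom 0 = 0 :=
  Fin.succ_succAbove_zero i

theorem σ_map_zero (n : ℕ) (i : Fin (n + 1)) :
    (SimplexCategory.σ i).toOrderHom 0 = 0 :=
  Fin.predAbove_right_zero (i := i)

/-! ### The Kan loop group -/

/-- The relators `s₀ x`, for `x` in degree `n`, in the free group on the simplices of degree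
`n + 1`. -/
def loopRels (X : SSet.{u}) (n : ℕ) : Set (FreeGroup (X _⦋n + 1⦌)) :=
  Set.range fun x : X _⦋n⦌ ↦ FreeGroup.of (X.σ 0 x)

/-- The class `[x]` in degree `n` of the loop group, for a simplex `x` of degree `n + 1`. -/
def loopOf (X : SSet.{u}) (n : ℕ) (x : X _⦋n + 1⦌) : PresentedGroup (loopRels X n) :=
  PresentedGroup.of x

theorem loopOf_s0 (X : SSet.{u}) (n : ℕ) (x : X _⦋n⦌) : loopOf X n (X.σ 0 x) = 1 :=
  PresentedGroup.one_of_mem ⟨x, rfl⟩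

theorem map_map_apply (X : SSet.{u}) {a b c : SimplexCategory} (β : a ⟶ b) (α : b ⟶ c)
    (x : X.obj (op c)) : X.map β.op (X.map α.op x) = X.map (β ≫ α).op x := by
  rw [op_comp, X.map_comp]; rfl

/-- The structure map `α^*` of the loop group: `α^*[x] = [x ∘ coneOne α]⁻¹ [x ∘ conePlus α]`. -/
def loopMap (X : SSet.{u}) {a b : SimplexCategory} (α : a ⟶ b) :
    PresentedGroup (loopRels X b.len) →* PresentedGroup (loopRels X a.len) :=
  PresentedGroup.toGroup
    (f := fun x ↦ (loopOf X a.len (X.map (coneOne α).op x))⁻¹ *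
      loopOf X a.len (X.map (conePlus α).op x)) (by
    rintro _ ⟨y, rfl⟩
    have h : X.map (coneOne α).op (X.σ 0 y) = X.map (conePlus α).op (X.σ 0 y) := by
      refine (map_map_apply X (coneOne α) (SimplexCategory.σ (0 : Fin (b.len + 1))) y).trans ?_
      rw [coneOne_σ_zero]
      exact (map_map_apply X (conePlus α) (SimplexCategory.σ (0 : Fin (b.len + 1))) y).symm
    rw [FreeGroup.lift_apply_of, h, inv_mul_cancel])

theorem loopMap_of (X : SSet.{u}) {a b : SimplexCategory} (α : a ⟶ b) (x : X _⦋b.len + 1⦌) :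
    loopMap X α (loopOf X b.len x) = (loopOf X a.len (X.map (coneOne α).op x))⁻¹ *
      loopOf X a.len (X.map (conePlus α).op x) :=
  PresentedGroup.toGroup.of _

theorem loopMap_id (X : SSet.{u}) (a : SimplexCategory) : loopMap X (𝟙 a) = MonoidHom.id _ := by
  apply PresentedGroup.ext
  intro x
  refine (loopMap_of X (𝟙 a) x).trans ?_
  have h : X.map (coneOne (𝟙 a)).op x = X.σ 0 (X.δ 0 x) := by
    rw [coneOne_id]; exact (map_map_apply X _ _ x).symm
  rw [h, loopOf_s0, conePlus_id, op_id, X.map_id]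
  simp [loopOf]

theorem loopMap_comp (X : SSet.{u}) {a b c : SimplexCategory} (β : a ⟶ b) (α : b ⟶ c) :
    loopMap X (β ≫ α) = (loopMap X β).comp (loopMap X α) := by
  apply PresentedGroup.ext
  intro x
  refine (loopMap_of X (β ≫ α) x).trans ?_
  change _ = loopMap X β (loopMap X α (loopOf X c.len x))
  rw [loopMap_of, map_mul, map_inv, loopMap_of, loopMap_of]
  simp only [map_map_apply]
  rw [coneOne_comp, conePlus_comp, coneOne_comp']
  group

/-- The Kan loop group `ΩX`: in degree `n` it is the free group on `X_{n+1}` modulo `s₀ x = 1`.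
(It is used for reduced `X` only.) -/
def loopGroup (X : SSet.{u}) : SimplicialObject GrpCat.{u} where
  obj Δ := GrpCat.of (PresentedGroup (loopRels X Δ.unop.len))
  map f := GrpCat.ofHom (loopMap X f.unop)
  map_id Δ := by rw [unop_id, loopMap_id]; rfl
  map_comp f g := by rw [unop_comp, loopMap_comp]; rfl

/-- The generator `[x]` of `ΩX`. -/
def loopGen (X : SSet.{u}) (n : ℕ) (x : X _⦋n + 1⦌) : (loopGroup X) _⦋n⦌ :=
  loopOf X n x

theorem loopGroup_δ_zero (X : SSet.{u}) (n : ℕ) (x : X _⦋n + 2⦌) :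
    (loopGroup X).δ 0 (loopGen X (n + 1) x) =
      (loopGen X n (X.δ 0 x))⁻¹ * loopGen X n (X.δ 1 x) := by
  refine (loopMap_of X (SimplexCategory.δ (0 : Fin (n + 2))) x).trans ?_
  rw [coneOne_δ_zero, conePlus_δ]
  rfl

theorem loopMap_of_zero (X : SSet.{u}) {a b : SimplexCategory} (α : a ⟶ b)
    (h : α.toOrderHom 0 = 0) (x : X _⦋b.len + 1⦌) :
    loopMap X α (loopOf X b.len x) = loopOf X a.len (X.map (conePlus α).op x) := by
  rw [loopMap_of, coneOne_of_zero α h, ← map_map_apply]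
  erw [loopOf_s0]
  simp

theorem loopGroup_δ_succ (X : SSet.{u}) (n : ℕ) (i : Fin (n + 1)) (x : X _⦋n + 2⦌) :
    (loopGroup X).δ i.succ (loopGen X (n + 1) x) = loopGen X n (X.δ i.succ.succ x) := by
  refine (loopMap_of_zero X (SimplexCategory.δ i.succ) (δ_succ_zero n i) x).trans ?_
  rw [conePlus_δ]
  rfl

theorem loopGroup_σ (X : SSet.{u}) (n : ℕ) (i : Fin (n + 1)) (x : X _⦋n + 1⦌) :
    (loopGroup X).σ i (loopGen X n x) = loopGen X (n + 1) (X.σ i.succ x) := by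
  refine (loopMap_of_zero X (SimplexCategory.σ i) (σ_map_zero n i) x).trans ?_
  rw [conePlus_σ]
  rfl

/-! ### Twisting functions, actions and twisted Cartesian products -/

/-- A twisting function `τ : B_{n+1} → G_n`. -/
structure TwistingFunction (B : SSet.{u}) (G : SimplicialObject GrpCat.{u}) where
  toFun : ∀ n : ℕ, B _⦋n + 1⦌ → G _⦋n⦌
  δ_zero : ∀ (n : ℕ) (b : B _⦋n + 2⦌),
    G.δ 0 (toFun (n + 1) b) = (toFun n (B.δ 0 b))⁻¹ * toFun n (B.δ 1 b)
  δ_succ : ∀ (n : ℕ) (i : Fin (n + 1)) (b : B _⦋n + 2⦌),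
    G.δ i.succ (toFun (n + 1) b) = toFun n (B.δ i.succ.succ b)
  σ_eq : ∀ (n : ℕ) (i : Fin (n + 1)) (b : B _⦋n + 1⦌),
    G.σ i (toFun n b) = toFun (n + 1) (B.σ i.succ b)
  σ_zero : ∀ (n : ℕ) (b : B _⦋n⦌), toFun n (B.σ 0 b) = 1

/-- The canonical twisting function `x ↦ [x]` from `X` to its loop group. -/
def loopTwisting (X : SSet.{u}) : TwistingFunction X (loopGroup X) where
  toFun := loopGen X
  δ_zero := loopGroup_δ_zero X
  δ_succ := loopGroup_δ_succ X
  σ_eq := loopGroup_σ X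
  σ_zero := loopOf_s0 X

/-- A left action of a simplicial group on a simplicial set. -/
structure SimplicialAction (G : SimplicialObject GrpCat.{u}) (F : SSet.{u}) where
  smul : ∀ Δ : SimplexCategoryᵒᵖ, G.obj Δ → F.obj Δ → F.obj Δ
  one_smul : ∀ Δ x, smul Δ 1 x = x
  mul_smul : ∀ Δ g h x, smul Δ (g * h) x = smul Δ g (smul Δ h x)
  map_smul : ∀ {Δ Δ' : SimplexCategoryᵒᵖ} (f : Δ ⟶ Δ') (g : G.obj Δ) (x : F.obj Δ),
    F.map f (smul Δ g x) = smul Δ' (G.map f g) (F.map f x)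

theorem grp_map_map_apply (G : SimplicialObject GrpCat.{u}) {a b c : SimplexCategory}
    (β : a ⟶ b) (α : b ⟶ c) (x : G.obj (op c)) :
    G.map β.op (G.map α.op x) = G.map (β ≫ α).op x := by
  rw [op_comp, G.map_comp]; rfl

theorem grp_map_id_apply (G : SimplicialObject GrpCat.{u}) {a : SimplexCategory}
    (x : G.obj (op a)) : G.map (𝟙 a).op x = x := by
  rw [op_id, G.map_id]; rfl

namespace TwistingFunction

variable {B : SSet.{u}} {G : SimplicialObject GrpCat.{u}}

theorem map_of_zero (τ : TwistingFunction B G) {a b : SimplexCategory} (α : a ⟶ b)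
    (h : α.toOrderHom 0 = 0) (y : B _⦋b.len + 1⦌) : τ.toFun a.len (B.map (coneOne α).op y) = 1 := by
  rw [coneOne_of_zero α h, ← map_map_apply]
  exact τ.σ_zero _ _

/-- The behaviour of a twisting function under an arbitrary simplicial operator. -/
theorem map_eq (τ : TwistingFunction B G) {a b : SimplexCategory} (α : a ⟶ b)
    (y : B _⦋b.len + 1⦌) :
    G.map α.op (τ.toFun b.len y) =
      (τ.toFun a.len (B.map (coneOne α).op y))⁻¹ * τ.toFun a.len (B.map (conePlus α).op y) := by
  let W : MorphismProperty SimplexCategory := fun a b α ↦ ∀ y : B _⦋b.len + 1⦌,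
    G.map α.op (τ.toFun b.len y) =
      (τ.toFun a.len (B.map (coneOne α).op y))⁻¹ * τ.toFun a.len (B.map (conePlus α).op y)
  have : W.IsMultiplicative :=
    { id_mem := by
        intro a y
        have h : B.map (coneOne (𝟙 a)).op y = B.σ 0 (B.δ 0 y) := by
          rw [coneOne_id]; exact (map_map_apply B _ _ y).symm
        rw [h, τ.σ_zero, conePlus_id, op_id, G.map_id]
        simp
      comp_mem := by
        intro a b c β α hβ hα y
        rw [← grp_map_map_apply]
        have := hα y
        rw [this, map_mul, map_inv]
        erw [hβ, hβ]
        simp only [map_map_apply]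
        rw [coneOne_comp, conePlus_comp, coneOne_comp']
        group }
  have hW : W = ⊤ := by
    apply SimplexCategory.morphismProperty_eq_top
    · intro n i y
      induction i using Fin.cases with
      | zero =>
        refine (τ.δ_zero n y).trans ?_
        rw [coneOne_δ_zero, conePlus_δ]
        rfl
      | succ i =>
        refine (τ.δ_succ n i y).trans ?_
        rw [map_of_zero τ _ (δ_succ_zero n i), conePlus_δ, inv_one, one_mul]
        rfl
    · intro n i y
      refine (τ.σ_eq n i y).trans ?_
      rw [map_of_zero τ _ (σ_map_zero n i), conePlus_σ, inv_one, one_mul]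
      rfl
  have : W α := by rw [hW]; trivial
  exact this y

/-- The twist `τ(b ∘ coneZero α)` occurring in `α^*(f, b)`. -/
def twist (τ : TwistingFunction B G) {a b : SimplexCategory} (α : a ⟶ b) (y : B.obj (op b)) :
    G.obj (op a) :=
  τ.toFun a.len (B.map (coneZero α).op y)

theorem twist_of_zero (τ : TwistingFunction B G) {a b : SimplexCategory} (α : a ⟶ b)
    (h : α.toOrderHom 0 = 0) (y : B.obj (op b)) : τ.twist α y = 1 := by
  rw [twist, coneZero_of_zero α h, ← map_map_apply]
  exact τ.σ_zero _ _

theorem twist_comp (τ : TwistingFunction B G) {a b c : SimplexCategory} (β : a ⟶ b) (α : b ⟶ c)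
    (y : B.obj (op c)) :
    τ.twist (β ≫ α) y = τ.twist β (B.map α.op y) * G.map β.op (τ.twist α y) := by
  have h1 : coneZero β ≫ α = coneOne β ≫ coneZero α := by
    apply hom_ext_succ
    · rfl
    · intro k; rfl
  have h2 : coneZero (β ≫ α) = conePlus β ≫ coneZero α := by
    apply hom_ext_succ
    · rfl
    · intro k; rfl
  unfold twist
  rw [map_map_apply, h1, h2]
  have := τ.map_eq β (B.map (coneZero α).op y)
  erw [this]
  rw [map_map_apply, map_map_apply, mul_inv_cancel_left]

end TwistingFunction

/-- The fibre bundle (twisted Cartesian product) `F ×_τ B`: in degree `n` it is `F_n × B_n`, and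
`α^*(f, b) = (τ(b ∘ coneZero α) • α^* f, α^* b)`. -/
def twistedProduct {F B : SSet.{u}} {G : SimplicialObject GrpCat.{u}}
    (A : SimplicialAction G F) (τ : TwistingFunction B G) : SSet.{u} where
  obj Δ := F.obj Δ × B.obj Δ
  map {Δ Δ'} f := TypeCat.ofHom fun p : F.obj Δ × B.obj Δ ↦
    ((A.smul Δ' (τ.twist f.unop p.2) (F.map f p.1), B.map f p.2) : F.obj Δ' × B.obj Δ')
  map_id Δ := by
    ext p
    · change A.smul Δ (τ.twist (𝟙 Δ.unop) p.2) (F.map (𝟙 Δ) p.1) = p.1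
      rw [τ.twist_of_zero _ rfl, A.one_smul, F.map_id]
      rfl
    · change B.map (𝟙 Δ) p.2 = p.2
      rw [B.map_id]
      rfl
  map_comp {Δ Δ' Δ''} f g := by
    ext p
    · change A.smul Δ'' (τ.twist (g.unop ≫ f.unop) p.2) (F.map (f ≫ g) p.1) =
        A.smul Δ'' (τ.twist g.unop (B.map f p.2)) (F.map g (A.smul Δ' (τ.twist f.unop p.2)
          (F.map f p.1)))
      rw [τ.twist_comp, A.mul_smul, A.map_smul, F.map_comp]
      rfl
    · change B.map (f ≫ g) p.2 = B.map g (B.map f p.2)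
      rw [B.map_comp]
      rfl

section
variable {F B : SSet.{u}} {G : SimplicialObject GrpCat.{u}}
  (A : SimplicialAction G F) (τ : TwistingFunction B G)

theorem twistedProduct_δ_zero (n : ℕ) (f : F _⦋n + 1⦌) (b : B _⦋n + 1⦌) :
    (twistedProduct A τ).δ 0 ((f, b) : F _⦋n + 1⦌ × B _⦋n + 1⦌) =
      ((A.smul (op ⦋n⦌) (τ.toFun n b) (F.δ 0 f), B.δ 0 b) : F _⦋n⦌ × B _⦋n⦌) := by
  have h : τ.twist (SimplexCategory.δ (0 : Fin (n + 2))) b = τ.toFun n b := by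
    rw [TwistingFunction.twist, coneZero_δ_zero, op_id, B.map_id]; rfl
  rw [← h]
  rfl

theorem twistedProduct_δ_succ (n : ℕ) (i : Fin (n + 1)) (f : F _⦋n + 1⦌) (b : B _⦋n + 1⦌) :
    (twistedProduct A τ).δ i.succ ((f, b) : F _⦋n + 1⦌ × B _⦋n + 1⦌) =
      ((F.δ i.succ f, B.δ i.succ b) : F _⦋n⦌ × B _⦋n⦌) := by
  change ((A.smul (op ⦋n⦌) (τ.twist (SimplexCategory.δ i.succ) b) (F.δ i.succ f),
    B.δ i.succ b) : F _⦋n⦌ × B _⦋n⦌) = _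
  rw [τ.twist_of_zero _ (δ_succ_zero n i), A.one_smul]

theorem twistedProduct_σ (n : ℕ) (i : Fin (n + 1)) (f : F _⦋n⦌) (b : B _⦋n⦌) :
    (twistedProduct A τ).σ i ((f, b) : F _⦋n⦌ × B _⦋n⦌) =
      ((F.σ i f, B.σ i b) : F _⦋n + 1⦌ × B _⦋n + 1⦌) := by
  change ((A.smul (op ⦋n + 1⦌) (τ.twist (SimplexCategory.σ i) b) (F.σ i f),
    B.σ i b) : F _⦋n + 1⦌ × B _⦋n + 1⦌) = _
  rw [τ.twist_of_zero _ (σ_map_zero n i), A.one_smul]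

/-- The projection `F ×_τ B ⟶ B`. -/
def twistedProductProj : twistedProduct A τ ⟶ B where
  app Δ := TypeCat.ofHom fun p : F.obj Δ × B.obj Δ ↦ p.2
  naturality _ _ _ := rfl

end

/-! ### The classifying space -/

section
variable (G : SimplicialObject GrpCat.{u})

/-- Bars `[g_{n-1} | … | g_0]` with `g_i ∈ G_i`. -/
abbrev Bar (n : ℕ) : Type u := ∀ i : Fin n, G _⦋(i : ℕ)⦌

variable {G}

/-- The entry `g_i` of a bar, extended by `1` for `i ≥ n`. -/
def Bar.get {n : ℕ} (g : Bar G n) (i : ℕ) : G _⦋i⦌ :=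
  if h : i < n then g ⟨i, h⟩ else 1

/-- The map `⦋q⦌ ⟶ ⦋p⦌` which, for `q ≤ p`, is the inclusion of the last `q + 1` vertices; it
induces the iterated face map `∂₀^{p-q} : G_p → G_q`. -/
def lastHom (p q : ℕ) : ⦋q⦌ ⟶ ⦋p⦌ :=
  SimplexCategory.Hom.mk
    { toFun := fun k : Fin (q + 1) ↦ (⟨p - (q - k), by omega⟩ : Fin (p + 1))
      monotone' := by
        intro x y h
        have : (x : ℕ) ≤ y := h
        change p - (q - (x : ℕ)) ≤ p - (q - (y : ℕ))
        omega }

/-- The element `∂₀^{a-1-q} g_{a-1} ⋯ ∂₀ g_{q+1} g_q` of `G_q` (it is `1` for `a ≤ q`). -/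
def Bar.prod {n : ℕ} (g : Bar G n) (q a : ℕ) : G _⦋q⦌ :=
  match a with
  | 0 => 1
  | a + 1 => if q ≤ a then G.map (lastHom a q).op (g.get a) * Bar.prod g q a else Bar.prod g q a

/-- For `α : ⦋m⦌ ⟶ ⦋n⦌`, the vertex `α (m - i)`, counted from the end. -/
def revVal {a b : SimplexCategory} (α : a ⟶ b) (i : ℕ) : ℕ :=
  b.len - (α.toOrderHom (⟨a.len - i, by omega⟩ : Fin (a.len + 1)) : Fin (b.len + 1)).val

/-- The restriction of `α` to the last `i + 1` vertices, as a map to the vertices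
of the target from `α (m - i)` on. -/
def revHom {a b : SimplexCategory} (α : a ⟶ b) (i : ℕ) : ⦋i⦌ ⟶ ⦋revVal α i⦌ :=
  SimplexCategory.Hom.mk
    { toFun := fun k : Fin (i + 1) ↦
        (⟨(α.toOrderHom (⟨a.len - (i - k), by omega⟩ : Fin (a.len + 1)) : Fin (b.len + 1)).val -
          (α.toOrderHom (⟨a.len - i, by omega⟩ : Fin (a.len + 1)) : Fin (b.len + 1)).val, by
          have := (α.toOrderHom (⟨a.len - (i - k), by omega⟩ : Fin (a.len + 1))).isLt
          unfold revVal
          omega⟩ : Fin (revVal α i + 1))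
      monotone' := by
        intro x y h
        have hxy : (x : ℕ) ≤ y := h
        have := α.toOrderHom.monotone
          (show (⟨a.len - (i - x), by omega⟩ : Fin (a.len + 1)) ≤ ⟨a.len - (i - y), by omega⟩ by
            rw [Fin.mk_le_mk]; omega)
        rw [Fin.le_def] at this ⊢
        exact Nat.sub_le_sub_right this _ }

/-- The simplicial operator `α^*` on bars: the entry of `α^* g` belonging to the edge from `j` to
`j + 1` is the product of the entries of `g` belonging to the edges between `α j` and `α (j + 1)`,
pulled back along the restriction of `α` to the vertices from `j + 1` on. -/
def Bar.map {a b : SimplexCategory} (α : a ⟶ b) (g : Bar G b.len) : Bar G a.len :=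
  fun i ↦ G.map (revHom α i).op (g.prod (revVal α i) (revVal α (i + 1)))

theorem lastHom_comp {q b a : ℕ} (h1 : q ≤ b) (h2 : b ≤ a) :
    lastHom b q ≫ lastHom a b = lastHom a q := by
  apply hom_ext_fin
  intro k
  apply Fin.ext
  change a - (b - (b - (q - (k : ℕ)))) = a - (q - (k : ℕ))
  omega

theorem lastHom_self (q : ℕ) : lastHom q q = 𝟙 ⦋q⦌ := by
  apply hom_ext_fin
  intro k
  apply Fin.ext
  have : (k : ℕ) < q + 1 := k.isLt
  change q - (q - (k : ℕ)) = k
  omega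

theorem Bar.prod_succ {n : ℕ} (g : Bar G n) {q a : ℕ} (h : q ≤ a) :
    g.prod q (a + 1) = G.map (lastHom a q).op (g.get a) * g.prod q a := by
  rw [Bar.prod, if_pos h]

theorem Bar.prod_of_le {n : ℕ} (g : Bar G n) {q a : ℕ} (h : a ≤ q) : g.prod q a = 1 := by
  induction a with
  | zero => rfl
  | succ a ih => rw [Bar.prod, if_neg (by omega), ih (by omega)]

theorem Bar.prod_self_succ {n : ℕ} (g : Bar G n) (q : ℕ) : g.prod q (q + 1) = g.get q := by
  rw [g.prod_succ le_rfl, g.prod_of_le le_rfl, mul_one, lastHom_self, grp_map_id_apply]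

theorem Bar.prod_mul {n : ℕ} (g : Bar G n) {q b a : ℕ} (h1 : q ≤ b) (h2 : b ≤ a) :
    g.prod q a = G.map (lastHom b q).op (g.prod b a) * g.prod q b := by
  induction a, h2 using Nat.le_induction with
  | base => rw [g.prod_of_le le_rfl, map_one, one_mul]
  | succ a h ih =>
    rw [g.prod_succ h, g.prod_succ (h1.trans h), map_mul, grp_map_map_apply, lastHom_comp h1 h, ih,
      mul_assoc]

theorem revVal_mono {a b : SimplexCategory} (α : a ⟶ b) {i j : ℕ} (h : i ≤ j) :
    revVal α i ≤ revVal α j := by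
  have := α.toOrderHom.monotone
    (show (⟨a.len - j, by omega⟩ : Fin (a.len + 1)) ≤ ⟨a.len - i, by omega⟩ by
      rw [Fin.mk_le_mk]; omega)
  rw [Fin.le_def] at this
  exact Nat.sub_le_sub_left this _

theorem revVal_le {a b : SimplexCategory} (α : a ⟶ b) (i : ℕ) : revVal α i ≤ b.len :=
  Nat.sub_le _ _

theorem toOrderHom_congr {a b : SimplexCategory} (α : a ⟶ b) {i j : ℕ} (hi : i < a.len + 1)
    (h : i = j) :
    (α.toOrderHom (⟨i, hi⟩ : Fin (a.len + 1)) : Fin (b.len + 1)).val =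
      (α.toOrderHom (⟨j, h ▸ hi⟩ : Fin (a.len + 1)) : Fin (b.len + 1)).val := by
  subst h; rfl

theorem lastHom_revHom {a b : SimplexCategory} (α : a ⟶ b) {q i : ℕ} (h : q ≤ i)
    (hi : i ≤ a.len) :
    lastHom i q ≫ revHom α i = revHom α q ≫ lastHom (revVal α i) (revVal α q) := by
  apply hom_ext_fin
  intro k
  apply Fin.ext
  change (α.toOrderHom (⟨a.len - (i - (i - (q - (k : ℕ)))), by omega⟩ : Fin (a.len + 1)) :
      Fin (b.len + 1)).val - _ = revVal α i - (revVal α q - ((α.toOrderHom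
        (⟨a.len - (q - (k : ℕ)), by omega⟩ : Fin (a.len + 1)) : Fin (b.len + 1)).val -
        (α.toOrderHom (⟨a.len - q, by omega⟩ : Fin (a.len + 1)) : Fin (b.len + 1)).val))
  rw [toOrderHom_congr α _ (show a.len - (i - (i - (q - (k : ℕ)))) = a.len - (q - (k : ℕ)) by omega)]
  have h1 := α.toOrderHom.monotone
    (show (⟨a.len - q, by omega⟩ : Fin (a.len + 1)) ≤ ⟨a.len - (q - (k : ℕ)), by omega⟩ by
      rw [Fin.mk_le_mk]; omega)
  have h2 := α.toOrderHom.monotone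
    (show (⟨a.len - i, by omega⟩ : Fin (a.len + 1)) ≤ ⟨a.len - q, by omega⟩ by
      rw [Fin.mk_le_mk]; omega)
  have h3 := (α.toOrderHom (⟨a.len - (q - (k : ℕ)), by omega⟩ : Fin (a.len + 1))).isLt
  rw [Fin.le_def] at h1 h2
  unfold revVal
  omega

theorem Bar.prod_map {a b : SimplexCategory} (α : a ⟶ b) (g : Bar G b.len) {q i : ℕ}
    (h : q ≤ i) (hi : i ≤ a.len) :
    (g.map α).prod q i = G.map (revHom α q).op (g.prod (revVal α q) (revVal α i)) := by
  induction i, h using Nat.le_induction with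
  | base => rw [Bar.prod_of_le _ le_rfl, Bar.prod_of_le _ le_rfl, map_one]
  | succ i h ih =>
    have hget : (g.map α).get i = G.map (revHom α i).op (g.prod (revVal α i) (revVal α (i + 1))) := by
      rw [Bar.get, dif_pos (by omega)]; rfl
    rw [Bar.prod_succ _ h, ih (by omega), hget, grp_map_map_apply, lastHom_revHom α h (by omega),
      ← grp_map_map_apply, ← map_mul, ← g.prod_mul (revVal_mono α h) (revVal_mono α (by omega))]

theorem Bar.map_prod_congr {n i : ℕ} (g : Bar G n) {q q' a a' : ℕ} (hq : q = q') (ha : a = a')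
    (ρ : ⦋i⦌ ⟶ ⦋q⦌) (ρ' : ⦋i⦌ ⟶ ⦋q'⦌)
    (hρ : ∀ k : Fin (i + 1), (ρ.toOrderHom k : Fin (q + 1)).val =
      (ρ'.toOrderHom k : Fin (q' + 1)).val) :
    G.map ρ.op (g.prod q a) = G.map ρ'.op (g.prod q' a') := by
  subst hq ha
  have : ρ = ρ' := hom_ext_fin fun k ↦ Fin.ext (hρ k)
  rw [this]

theorem Bar.map_id {a : SimplexCategory} (g : Bar G a.len) : g.map (𝟙 a) = g := by
  funext i
  have hi := i.isLt
  have hv : ∀ j, j ≤ a.len → revVal (𝟙 a) j = j := by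
    intro j hj
    change a.len - (a.len - j) = j
    omega
  have := g.map_prod_congr (hv i (by omega)) (hv (i + 1) (by omega)) (revHom (𝟙 a) i) (𝟙 ⦋(i : ℕ)⦌) (by
    intro k
    change (a.len - (i - (k : ℕ))) - (a.len - i) = (k : ℕ)
    omega)
  refine this.trans ?_
  rw [g.prod_self_succ, grp_map_id_apply, Bar.get, dif_pos hi]

theorem revVal_comp {a b c : SimplexCategory} (β : a ⟶ b) (α : b ⟶ c) (i : ℕ) :
    revVal α (revVal β i) = revVal (β ≫ α) i := by
  have h := (β.toOrderHom (⟨a.len - i, by omega⟩ : Fin (a.len + 1))).isLt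
  change c.len - _ = c.len - _
  congr 1
  refine toOrderHom_congr α _ ?_
  exact Nat.sub_sub_self (Nat.lt_succ_iff.mp h)

theorem Bar.map_comp {a b c : SimplexCategory} (β : a ⟶ b) (α : b ⟶ c) (g : Bar G c.len) :
    (g.map α).map β = g.map (β ≫ α) := by
  funext i
  have hi := i.isLt
  change G.map (revHom β i).op ((g.map α).prod (revVal β i) (revVal β (i + 1))) = _
  rw [g.prod_map α (revVal_mono β (by omega)) (revVal_le β _), grp_map_map_apply]
  refine g.map_prod_congr (revVal_comp β α _) (revVal_comp β α _) _ _ ?_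
  intro k
  have h1 := β.toOrderHom.monotone
    (show (⟨a.len - i, by omega⟩ : Fin (a.len + 1)) ≤ ⟨a.len - (i - (k : ℕ)), by omega⟩ by
      rw [Fin.mk_le_mk]; omega)
  have h3 := (β.toOrderHom (⟨a.len - (i - (k : ℕ)), by omega⟩ : Fin (a.len + 1))).isLt
  rw [Fin.le_def] at h1
  have haux : ∀ B x y : ℕ, x ≤ y → y ≤ B → B - ((B - x) - (y - x)) = y := by
    intro B x y _ _
    omega
  refine congrArg₂ (· - ·) (toOrderHom_congr α _ ?_) (toOrderHom_congr α _ ?_)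
  · exact haux _ _ _ h1 (Nat.lt_succ_iff.mp h3)
  · exact Nat.sub_sub_self (Nat.lt_succ_iff.mp
      (β.toOrderHom (⟨a.len - i, by omega⟩ : Fin (a.len + 1))).isLt)

end

/-- The classifying space `BG` of a simplicial group. -/
def classifyingSpace (G : SimplicialObject GrpCat.{u}) : SSet.{u} where
  obj Δ := Bar G Δ.unop.len
  map f := TypeCat.ofHom fun g ↦ Bar.map f.unop g
  map_id Δ := by
    apply ConcreteCategory.hom_ext
    intro g
    exact Bar.map_id g
  map_comp f g := by
    apply ConcreteCategory.hom_ext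
    intro x
    exact (Bar.map_comp g.unop f.unop x).symm

/-- `BG` is reduced. -/
instance (G : SimplicialObject GrpCat.{u}) : Unique ((classifyingSpace G) _⦋0⦌) :=
  inferInstanceAs (Unique (∀ i : Fin 0, G _⦋(i : ℕ)⦌))

section
variable (G : SimplicialObject GrpCat.{u})

theorem δ_val {n : ℕ} (i : Fin (n + 2)) (v : ℕ) (hv : v < n + 1) :
    ((SimplexCategory.δ i).toOrderHom (⟨v, hv⟩ : Fin (n + 1)) : Fin (n + 2)).val =
      if v < i then v else v + 1 := by
  change (Fin.succAbove i (⟨v, hv⟩ : Fin (n + 1))).val = _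
  simp only [Fin.succAbove, Fin.lt_def]
  split_ifs <;> simp_all

theorem σ_val {n : ℕ} (i : Fin (n + 1)) (v : ℕ) (hv : v < n + 2) :
    ((SimplexCategory.σ i).toOrderHom (⟨v, hv⟩ : Fin (n + 2)) : Fin (n + 1)).val =
      if v ≤ i then v else v - 1 := by
  change (Fin.predAbove i (⟨v, hv⟩ : Fin (n + 2))).val = _
  simp only [Fin.predAbove, Fin.lt_def, Fin.val_castSucc]
  split_ifs <;> simp_all <;> omega

theorem revVal_δ {n : ℕ} (i : Fin (n + 2)) (j : ℕ) (hj : j ≤ n) :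
    revVal (SimplexCategory.δ i) j = if n < j + i then j + 1 else j := by
  change n + 1 - ((SimplexCategory.δ i).toOrderHom (⟨n - j, by omega⟩ : Fin (n + 1)) :
    Fin (n + 2)).val = _
  rw [δ_val]
  split_ifs <;> omega

theorem revVal_σ {n : ℕ} (i : Fin (n + 1)) (j : ℕ) (hj : j ≤ n + 1) :
    revVal (SimplexCategory.σ i) j = if n < j + i then j - 1 else j := by
  change n - ((SimplexCategory.σ i).toOrderHom (⟨n + 1 - j, by omega⟩ : Fin (n + 2)) :
    Fin (n + 1)).val = _
  rw [σ_val]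
  split_ifs <;> omega

/-- Entries of `∂_i g` for `g = [g_n | … | g_0]`: to the right of the position `n - i`. -/
theorem classifyingSpace_δ_right (n : ℕ) (i : Fin (n + 2)) (g : Bar G (n + 1)) (j : Fin n)
    (h : (j : ℕ) + i < n) :
    ((classifyingSpace G).δ i g : Bar G n) j = g j.castSucc := by
  have hj := j.isLt
  have := g.map_prod_congr
    (show revVal (SimplexCategory.δ i) j = j by rw [revVal_δ _ _ (by omega), if_neg (by omega)])
    (show revVal (SimplexCategory.δ i) (j + 1) = j + 1 by
      rw [revVal_δ _ _ (by omega), if_neg (by omega)])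
    (revHom (SimplexCategory.δ i) j) (𝟙 ⦋(j : ℕ)⦌) (by
      intro k
      change ((SimplexCategory.δ i).toOrderHom (⟨n - (j - (k : ℕ)), by omega⟩ : Fin (n + 1)) :
        Fin (n + 2)).val - ((SimplexCategory.δ i).toOrderHom (⟨n - j, by omega⟩ : Fin (n + 1)) :
        Fin (n + 2)).val = (k : ℕ)
      rw [δ_val, δ_val]
      split_ifs <;> omega)
  refine this.trans ?_
  rw [g.prod_self_succ, grp_map_id_apply, Bar.get, dif_pos (by omega)]
  rfl

/-- The entry of `∂_i g` at the position `n - i`. -/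
theorem classifyingSpace_δ_mid (n : ℕ) (i : Fin (n + 2)) (g : Bar G (n + 1)) (j : Fin n)
    (h : (j : ℕ) + i = n) :
    ((classifyingSpace G).δ i g : Bar G n) j =
      G.δ 0 (g j.succ) * (show G _⦋(j : ℕ)⦌ from g j.castSucc) := by
  have hj := j.isLt
  have := g.map_prod_congr
    (show revVal (SimplexCategory.δ i) j = j by rw [revVal_δ _ _ (by omega), if_neg (by omega)])
    (show revVal (SimplexCategory.δ i) (j + 1) = j + 2 by
      rw [revVal_δ _ _ (by omega), if_pos (by omega)])
    (revHom (SimplexCategory.δ i) j) (𝟙 ⦋(j : ℕ)⦌) (by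
      intro k
      change ((SimplexCategory.δ i).toOrderHom (⟨n - (j - (k : ℕ)), by omega⟩ : Fin (n + 1)) :
        Fin (n + 2)).val - ((SimplexCategory.δ i).toOrderHom (⟨n - j, by omega⟩ : Fin (n + 1)) :
        Fin (n + 2)).val = (k : ℕ)
      rw [δ_val, δ_val]
      split_ifs <;> omega)
  refine this.trans ?_
  have hl : lastHom (j + 1) j = SimplexCategory.δ (0 : Fin (j + 2)) := by
    apply hom_ext_fin
    rintro ⟨k, hk⟩
    apply Fin.ext
    change k < j + 1 at hk
    refine Eq.trans ?_ (δ_val (n := j) 0 k hk).symm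
    change (j + 1 : ℕ) - (j - k) = if k < 0 then k else k + 1
    split_ifs <;> omega
  rw [grp_map_id_apply, g.prod_succ (Nat.le_succ _), g.prod_self_succ, hl, Bar.get,
    dif_pos (by omega), Bar.get, dif_pos (by omega)]
  rfl

/-- Entries of `∂_i g` to the left of the position `n - i`. -/
theorem classifyingSpace_δ_left (n : ℕ) (i : Fin (n + 2)) (g : Bar G (n + 1)) (j : Fin n)
    (h : n < (j : ℕ) + i) :
    ((classifyingSpace G).δ i g : Bar G n) j =
      G.δ (⟨j + i - n, by omega⟩ : Fin (j + 2)) (g j.succ) := by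
  have hj := j.isLt
  have := g.map_prod_congr
    (show revVal (SimplexCategory.δ i) j = j + 1 by
      rw [revVal_δ _ _ (by omega), if_pos (by omega)])
    (show revVal (SimplexCategory.δ i) (j + 1) = j + 2 by
      rw [revVal_δ _ _ (by omega), if_pos (by omega)])
    (revHom (SimplexCategory.δ i) j)
    (SimplexCategory.δ (⟨j + i - n, by omega⟩ : Fin (j + 2))) (by
      rintro ⟨k, hk⟩
      refine Eq.trans ?_ (δ_val (n := j) _ k hk).symm
      change ((SimplexCategory.δ i).toOrderHom (⟨n - (j - k), by omega⟩ : Fin (n + 1)) :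
        Fin (n + 2)).val - ((SimplexCategory.δ i).toOrderHom (⟨n - j, by omega⟩ : Fin (n + 1)) :
        Fin (n + 2)).val = _
      rw [δ_val, δ_val]
      dsimp only
      split_ifs <;> omega)
  refine this.trans ?_
  rw [g.prod_self_succ, Bar.get, dif_pos (by omega)]
  rfl

/-- Entries of `s_i g` for `g = [g_{n-1} | … | g_0]`: to the right of the position `n - i`. -/
theorem classifyingSpace_σ_right (n : ℕ) (i : Fin (n + 1)) (g : Bar G n) (j : Fin n)
    (h : (j : ℕ) + i < n) :
    ((classifyingSpace G).σ i g : Bar G (n + 1)) j.castSucc = g j := by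
  have hj := j.isLt
  have := g.map_prod_congr
    (show revVal (SimplexCategory.σ i) j = j by rw [revVal_σ _ _ (by omega), if_neg (by omega)])
    (show revVal (SimplexCategory.σ i) (j + 1) = j + 1 by
      rw [revVal_σ _ _ (by omega)]; split_ifs <;> omega)
    (revHom (SimplexCategory.σ i) j) (𝟙 ⦋(j : ℕ)⦌) (by
      intro k
      change ((SimplexCategory.σ i).toOrderHom (⟨n + 1 - (j - (k : ℕ)), by omega⟩ : Fin (n + 2)) :
        Fin (n + 1)).val - ((SimplexCategory.σ i).toOrderHom
        (⟨n + 1 - j, by omega⟩ : Fin (n + 2)) : Fin (n + 1)).val = (k : ℕ)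
      rw [σ_val, σ_val]
      split_ifs <;> omega)
  refine this.trans ?_
  rw [g.prod_self_succ, grp_map_id_apply, Bar.get, dif_pos (by omega)]

/-- The entry of `s_i g` at the position `n - i`. -/
theorem classifyingSpace_σ_mid (n : ℕ) (i : Fin (n + 1)) (g : Bar G n) (j : Fin (n + 1))
    (h : (j : ℕ) + i = n) :
    ((classifyingSpace G).σ i g : Bar G (n + 1)) j = 1 := by
  have hj := j.isLt
  change G.map (revHom (SimplexCategory.σ i) j).op (g.prod (revVal (SimplexCategory.σ i) j)
    (revVal (SimplexCategory.σ i) (j + 1))) = 1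
  rw [g.prod_of_le, map_one]
  rw [revVal_σ _ _ (by omega), revVal_σ _ _ (by omega)]
  split_ifs <;> omega

/-- Entries of `s_i g` to the left of the position `n - i`. -/
theorem classifyingSpace_σ_left (n : ℕ) (i : Fin (n + 1)) (g : Bar G n) (j : Fin n)
    (h : n ≤ (j : ℕ) + i) :
    ((classifyingSpace G).σ i g : Bar G (n + 1)) j.succ =
      G.σ (⟨j + i - n, by omega⟩ : Fin (j + 1)) (g j) := by
  have hj := j.isLt
  have := g.map_prod_congr
    (show revVal (SimplexCategory.σ i) (j + 1) = j by
      rw [revVal_σ _ _ (by omega), if_pos (by omega)]; omega)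
    (show revVal (SimplexCategory.σ i) (j + 1 + 1) = j + 1 by
      rw [revVal_σ _ _ (by omega), if_pos (by omega)]; omega)
    (revHom (SimplexCategory.σ i) (j + 1))
    (SimplexCategory.σ (⟨j + i - n, by omega⟩ : Fin (j + 1))) (by
      rintro ⟨k, hk⟩
      refine Eq.trans ?_ (σ_val (n := j) _ k hk).symm
      change ((SimplexCategory.σ i).toOrderHom (⟨n + 1 - (j + 1 - k), by omega⟩ : Fin (n + 2)) :
        Fin (n + 1)).val - ((SimplexCategory.σ i).toOrderHom
        (⟨n + 1 - (j + 1), by omega⟩ : Fin (n + 2)) : Fin (n + 1)).val = _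
      rw [σ_val, σ_val]
      dsimp only
      split_ifs <;> omega)
  refine this.trans ?_
  rw [g.prod_self_succ, Bar.get, dif_pos (by omega)]
  rfl

end

theorem hom_grp_map_apply {G L : SimplicialObject GrpCat.{u}} (π : G ⟶ L)
    {Δ Δ' : SimplexCategoryᵒᵖ} (f : Δ ⟶ Δ') (x : G.obj Δ) :
    π.app Δ' (G.map f x) = L.map f (π.app Δ x) := by
  have := congrArg (fun h ↦ h x) (congrArg ConcreteCategory.hom (π.naturality f))
  exact this

/-- The entrywise map on bars induced by a morphism of simplicial groups. -/
def Bar.mapHom {G L : SimplicialObject GrpCat.{u}} (π : G ⟶ L) {n : ℕ} (g : Bar G n) : Bar L n :=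
  fun i ↦ π.app (op ⦋(i : ℕ)⦌) (g i)

theorem Bar.prod_mapHom {G L : SimplicialObject GrpCat.{u}} (π : G ⟶ L) {n : ℕ} (g : Bar G n)
    (q a : ℕ) : (g.mapHom π).prod q a = π.app (op ⦋q⦌) (g.prod q a) := by
  have hget : ∀ i, (g.mapHom π).get i = π.app (op ⦋i⦌) (g.get i) := by
    intro i
    unfold Bar.get
    split_ifs with h
    · rfl
    · rw [map_one]
  induction a with
  | zero => exact (map_one _).symm
  | succ a ih =>
    unfold Bar.prod
    split_ifs with h
    · rw [ih, map_mul, hom_grp_map_apply, hget]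
    · exact ih

/-- The map `BG ⟶ BL` induced by a morphism `G ⟶ L` of simplicial groups. -/
def classifyingSpaceMap {G L : SimplicialObject GrpCat.{u}} (π : G ⟶ L) :
    classifyingSpace G ⟶ classifyingSpace L where
  app Δ := TypeCat.ofHom fun g : Bar G Δ.unop.len ↦ g.mapHom π
  naturality Δ Δ' f := by
    apply ConcreteCategory.hom_ext
    intro (g : Bar G Δ.unop.len)
    change (g.map f.unop).mapHom π = (g.mapHom π).map f.unop
    funext i
    change π.app _ (G.map _ _) = L.map _ _
    rw [hom_grp_map_apply, Bar.prod_mapHom]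

/-! ### Extensions and pseudo-cross sections -/

/-- `1 → K → G → L → 1` is a short exact sequence of simplicial groups. -/
structure IsShortExact {K G L : SimplicialObject GrpCat.{u}} (ι : K ⟶ G) (π : G ⟶ L) : Prop where
  injective : ∀ Δ, Function.Injective (ι.app Δ)
  range_eq_ker : ∀ Δ, (ι.app Δ).hom.range = (π.app Δ).hom.ker
  surjective : ∀ Δ, Function.Surjective (π.app Δ)

/-- A pseudo-cross section of `π`: a section in each degree that commutes with all degeneracy maps
and with all face maps except possibly `∂₀`. -/
structure IsPseudoCrossSection {G L : SimplicialObject GrpCat.{u}} (π : G ⟶ L)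
    (s : ∀ n : ℕ, L _⦋n⦌ → G _⦋n⦌) : Prop where
  proj : ∀ (n : ℕ) (l : L _⦋n⦌), π.app (op ⦋n⦌) (s n l) = l
  δ_succ : ∀ (n : ℕ) (i : Fin (n + 1)) (l : L _⦋n + 1⦌),
    G.δ i.succ (s (n + 1) l) = s n (L.δ i.succ l)
  σ_eq : ∀ (n : ℕ) (i : Fin (n + 1)) (l : L _⦋n⦌), G.σ i (s n l) = s (n + 1) (L.σ i l)

/-! ### The explicit formulas

The entries of a bar in `BK` are written through their images in `G`. For a bar
`l = [l_{p-1} | … | l_0]` and `q ≤ a ≤ p` recall that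
`l.prod q a = ∂₀^{a-1-q} l_{a-1} ⋯ ∂₀ l_{q+1} l_q`. -/

section
variable {K G L : SimplicialObject GrpCat.{u}} (ι : K ⟶ G) (s : ∀ n : ℕ, L _⦋n⦌ → G _⦋n⦌)

/-- The bar in `BG` with entries `k_i σ(l_i)`, written `[(k_{n-1}, l_{n-1}) | … | (k_0, l_0)]`. -/
def pairBar {n : ℕ} (k : Bar K n) (l : Bar L n) : Bar G n :=
  fun i ↦ ι.app (op ⦋(i : ℕ)⦌) (k i) * s i (l i)

/-- The `i`-th entry of the `BK`-component of `Ψ [(k_{n-1}, l_{n-1}) | … | (k_0, l_0)]`: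
`∂₀σ(∂₀^{n-i-2} l_{n-1} ⋯ l_{i+1}) k_i σ(l_i) σ(∂₀^{n-i-1} l_{n-1} ⋯ l_i)⁻¹`. -/
def psiEntry {n : ℕ} (k : Bar K n) (l : Bar L n) (i : Fin n) : G _⦋(i : ℕ)⦌ :=
  G.δ 0 (s (i + 1) (l.prod (i + 1) n)) * ι.app (op ⦋(i : ℕ)⦌) (k i) * s i (l i) *
    (s i (l.prod i n))⁻¹

/-- The `i`-th entry of `[l_n | … | l_0] • [k_{n-1} | … | k_0]`:
`∂₀σ(∂₀^{n-i-2} l_{n-1} ⋯ l_{i+1}) (∂₀σ(∂₀^{n-i-1} l_n ⋯ l_{i+1}))⁻¹ k_i`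
`σ(∂₀^{n-i} l_n ⋯ l_i) σ(∂₀^{n-i-1} l_{n-1} ⋯ l_i)⁻¹`. -/
def actEntry {n : ℕ} (l : Bar L (n + 1)) (k : Bar K n) (i : Fin n) : G _⦋(i : ℕ)⦌ :=
  G.δ 0 (s (i + 1) (l.prod (i + 1) n)) * (G.δ 0 (s (i + 1) (l.prod (i + 1) (n + 1))))⁻¹ *
    ι.app (op ⦋(i : ℕ)⦌) (k i) * s i (l.prod i (n + 1)) * (s i (l.prod i n))⁻¹

end

/-- `p : E ⟶ B` is a fibre bundle with fibre `F` and structure group `H`: it is isomorphic over `B`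
to a twisted Cartesian product `F ×_τ B`. -/
def IsFibreBundle {E B : SSet.{u}} (p : E ⟶ B) (F : SSet.{u}) (H : SimplicialObject GrpCat.{u}) :
    Prop :=
  ∃ (A : SimplicialAction H F) (τ : TwistingFunction B H) (e : E ≅ twistedProduct A τ),
    e.hom ≫ twistedProductProj A τ = p

end SimplicialBundle

/-!
A bar `g = [g_{n-1} | … | g_0]` is determined by its partial products `P_i = g.prod i n ∈ G_i`, since
`g_i = (∂₀ P_{i+1})⁻¹ P_i`. Families `u = (u_i ∈ G_i)` act on bars from the right by gauge
transformations, `g_i ↦ (∂₀ u_{i+1})⁻¹ g_i u_i`, which multiplies `P_i` by `u_i` on the right and by a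
face of `u_n⁻¹` on the left (`Bar.prod_gauge`). An operator `α^*` carries the gauge transform of `g` by
`u` to that of `α^* g` by an explicit pullback of `u` (`Bar.map_gauge`).

Both formulas of the theorem are gauge transformations. The generator `[l_n | … | l_0]` acts on `BK`
through `u_i = σ(l_{(n+1,i)}) σ(l_{(n,i)})⁻¹`, and the `BK`-component of `Ψ` comes from
`u_i = σ(l_{(n,i)})⁻¹ = σ(π P_i)⁻¹`, so that on partial products it is `P ↦ P σ(π P)⁻¹`, as
`σ(1) = 1`. For the action, `π u_i = ∂₀^{n-i} l_n` is an iterated face of one element, so `u` preserves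
the bars in the kernel `K` and permutes them; `[s₀ l]` acts trivially because its `u` is `1`. Finally,
`Ψ` is bijective because the inverse gauge transformation recovers `g`.

What remains is compatibility with operators `α^*`. A pseudo-cross section commutes with every
operator fixing the initial vertex (`IsPseudoCrossSection.map_of_zero`), and the operators that occur
in the entries of `α^* g` are of this kind, for arbitrary `α`. Hence `σ` of a partial product of `α^* l`
is a pullback of `σ` of a partial product of `l`, and both the equivariance of the action and the
naturality of `Ψ` become telescoping identities (`IsPseudoCrossSection.map_loopGauge_mul`,
`IsPseudoCrossSection.map_sectionGauge_mul`).

A normalized pseudo-cross section is built by induction on the dimension: its value on a degenerate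
simplex `s_i x` is forced and well defined (`exists_of_σ_eq_σ`), and on a nondegenerate simplex one
fills the horn of the prescribed faces `∂_i`, `i ≥ 1`, over the given simplex of `L`
(`exists_lift_of_horn`).
-/

namespace SimplicialBundle

/-! ### Existence of pseudo-cross sections -/

theorem δ_apply_val {n : ℕ} (i : Fin (n + 2)) (k : Fin (n + 1)) :
    ((SimplexCategory.δ i).toOrderHom k : Fin (n + 2)).val =
      if k.val < i then k.val else k.val + 1 :=
  δ_val i k.val k.isLt

theorem σ_apply_val {n : ℕ} (i : Fin (n + 1)) (k : Fin (n + 2)) :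
    ((SimplexCategory.σ i).toOrderHom k : Fin (n + 1)).val =
      if k.val ≤ i then k.val else k.val - 1 :=
  σ_val i k.val k.isLt

section SimplicialIdentities

/-! The simplicial identities used below, for elements and with numerical side conditions. -/

variable (G : SimplicialObject GrpCat.{u})

theorem δσ_self {n : ℕ} {j : Fin (n + 2)} {i : Fin (n + 1)}
    (h : (j : ℕ) = i ∨ (j : ℕ) = i + 1) (x : G _⦋n⦌) : G.δ j (G.σ i x) = x := by
  refine (grp_map_map_apply G (SimplexCategory.δ j) (SimplexCategory.σ i) x).trans ?_
  have : SimplexCategory.δ j ≫ SimplexCategory.σ i = 𝟙 ⦋n⦌ := by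
    apply hom_ext_fin
    intro k
    apply Fin.ext
    refine (σ_apply_val i _).trans ?_
    rw [δ_apply_val]
    change _ = k.val
    split_ifs <;> omega
  rw [this, grp_map_id_apply]

theorem δσ_of_lt {n : ℕ} {j : Fin (n + 3)} {i : Fin (n + 2)} {j' : Fin (n + 2)} {i' : Fin (n + 1)}
    (h : (j : ℕ) < i) (hj : (j' : ℕ) = j) (hi : (i' : ℕ) + 1 = i) (x : G _⦋n + 1⦌) :
    G.δ j (G.σ i x) = G.σ i' (G.δ j' x) := by
  refine (grp_map_map_apply G (SimplexCategory.δ j) (SimplexCategory.σ i) x).trans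
    (Eq.trans ?_ (grp_map_map_apply G (SimplexCategory.σ i') (SimplexCategory.δ j') x).symm)
  have : SimplexCategory.δ j ≫ SimplexCategory.σ i =
      SimplexCategory.σ i' ≫ SimplexCategory.δ j' := by
    apply hom_ext_fin
    intro k
    apply Fin.ext
    refine (σ_apply_val i _).trans (Eq.trans ?_ (δ_apply_val j' _).symm)
    rw [δ_apply_val, σ_apply_val]
    split_ifs <;> omega
  rw [this]

theorem δσ_of_gt {n : ℕ} {j : Fin (n + 3)} {i : Fin (n + 2)} {j' : Fin (n + 2)} {i' : Fin (n + 1)}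
    (h : (i : ℕ) + 1 < j) (hj : (j' : ℕ) + 1 = j) (hi : (i' : ℕ) = i) (x : G _⦋n + 1⦌) :
    G.δ j (G.σ i x) = G.σ i' (G.δ j' x) := by
  refine (grp_map_map_apply G (SimplexCategory.δ j) (SimplexCategory.σ i) x).trans
    (Eq.trans ?_ (grp_map_map_apply G (SimplexCategory.σ i') (SimplexCategory.δ j') x).symm)
  have : SimplexCategory.δ j ≫ SimplexCategory.σ i =
      SimplexCategory.σ i' ≫ SimplexCategory.δ j' := by
    apply hom_ext_fin
    intro k
    apply Fin.ext
    refine (σ_apply_val i _).trans (Eq.trans ?_ (δ_apply_val j' _).symm)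
    rw [δ_apply_val, σ_apply_val]
    split_ifs <;> omega
  rw [this]

theorem δδ_of_le {n : ℕ} {i j : Fin (n + 2)} (h : i ≤ j) (x : G _⦋n + 2⦌) :
    G.δ i (G.δ j.succ x) = G.δ j (G.δ i.castSucc x) := by
  refine (grp_map_map_apply G (SimplexCategory.δ i) (SimplexCategory.δ j.succ) x).trans
    (Eq.trans ?_ (grp_map_map_apply G (SimplexCategory.δ j) (SimplexCategory.δ i.castSucc) x).symm)
  rw [SimplexCategory.δ_comp_δ h]

theorem σσ_of_lt {n : ℕ} {i j : Fin (n + 2)} {i' j' : Fin (n + 1)}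
    (h : i < j) (hi : (i' : ℕ) = i) (hj : (j' : ℕ) + 1 = j) (x : G _⦋n⦌) :
    G.σ j (G.σ i' x) = G.σ i (G.σ j' x) := by
  refine (grp_map_map_apply G (SimplexCategory.σ j) (SimplexCategory.σ i') x).trans
    (Eq.trans ?_ (grp_map_map_apply G (SimplexCategory.σ i) (SimplexCategory.σ j') x).symm)
  have : SimplexCategory.σ j ≫ SimplexCategory.σ i' =
      SimplexCategory.σ i ≫ SimplexCategory.σ j' := by
    apply hom_ext_fin
    intro k
    apply Fin.ext
    refine (σ_apply_val i' _).trans (Eq.trans ?_ (σ_apply_val j' _).symm)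
    rw [σ_apply_val, σ_apply_val]
    rw [Fin.lt_def] at h
    split_ifs <;> omega
  rw [this]

theorem σ_injective {n : ℕ} (i : Fin (n + 1)) : Function.Injective (G.σ i) := by
  intro x y h
  rw [← δσ_self G (j := i.succ) (i := i) (Or.inr rfl) x, h, δσ_self G (Or.inr rfl)]

/-- A simplex that is degenerate in two different directions `i < j` is doubly degenerate: the
weak form of the Eilenberg–Zilber lemma needed here. Only the faces `∂_k` with `k ≥ 1` are used. -/
theorem exists_of_σ_eq_σ {n : ℕ} {i j : Fin (n + 2)} (hij : i < j) {x y : G _⦋n + 1⦌}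
    (h : G.σ i x = G.σ j y) :
    ∃ (i' j' : Fin (n + 1)) (w : G _⦋n⦌), (i' : ℕ) = i ∧ (j' : ℕ) + 1 = j ∧
      x = G.σ j' w ∧ y = G.σ i' w := by
  have hlt : (i : ℕ) < j := hij
  have hj := j.isLt
  -- `y = ∂_{j+1} s_j y = ∂_{j+1} s_i x = s_i ∂_j x`
  have hy : y = G.σ (⟨i, by omega⟩ : Fin (n + 1)) (G.δ j x) := by
    rw [← δσ_self G (j := j.succ) (i := j) (Or.inr rfl) y, ← h]
    exact δσ_of_gt G (by simpa using hlt) rfl rfl x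
  refine ⟨⟨i, by omega⟩, ⟨j - 1, by omega⟩, G.δ j x, rfl, by simp; omega, ?_, hy⟩
  apply σ_injective G i
  rw [h]
  nth_rewrite 1 [hy]
  exact σσ_of_lt G hij rfl (by simp; omega) _

end SimplicialIdentities

theorem hom_δ {G L : SimplicialObject GrpCat.{u}} (π : G ⟶ L) {n : ℕ} (i : Fin (n + 2))
    (x : G _⦋n + 1⦌) : π.app (op ⦋n⦌) (G.δ i x) = L.δ i (π.app (op ⦋n + 1⦌) x) :=
  hom_grp_map_apply π _ x

theorem hom_σ {G L : SimplicialObject GrpCat.{u}} (π : G ⟶ L) {n : ℕ} (i : Fin (n + 1))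
    (x : G _⦋n⦌) : π.app (op ⦋n + 1⦌) (G.σ i x) = L.σ i (π.app (op ⦋n⦌) x) :=
  hom_grp_map_apply π _ x

section CrossSection

variable {G L : SimplicialObject GrpCat.{u}} (π : G ⟶ L)

/-- A surjection of simplicial groups has the lifting property for the horns that omit the zeroth
face. An arbitrary lift is corrected one face at a time, from the last face downwards. -/
theorem exists_lift_of_horn (hπ : ∀ Δ, Function.Surjective (π.app Δ)) {n : ℕ}
    (l : L _⦋n + 2⦌) (z : Fin (n + 2) → G _⦋n + 1⦌)
    (hz : ∀ i, π.app (op ⦋n + 1⦌) (z i) = L.δ i.succ l)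
    (hc : ∀ k i : Fin (n + 1), k ≤ i → G.δ i.succ (z k.castSucc) = G.δ k.succ (z i.succ)) :
    ∃ g : G _⦋n + 2⦌, π.app (op ⦋n + 2⦌) g = l ∧ ∀ i, G.δ i.succ g = z i := by
  suffices H : ∀ m : ℕ, ∀ k : ℕ, k + m = n + 2 → ∃ g : G _⦋n + 2⦌, π.app (op ⦋n + 2⦌) g = l ∧
      ∀ i : Fin (n + 2), k ≤ i → G.δ i.succ g = z i by
    obtain ⟨g, h1, h2⟩ := H (n + 2) 0 (by omega)
    exact ⟨g, h1, fun i ↦ h2 i (Nat.zero_le _)⟩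
  intro m
  induction m with
  | zero =>
    intro k hk
    obtain ⟨g, hg⟩ := hπ _ l
    exact ⟨g, hg, fun i hi ↦ absurd i.isLt (by omega)⟩
  | succ m ih =>
    intro k hk
    obtain ⟨g, hg, hg'⟩ := ih (k + 1) (by omega)
    have hkn : k < n + 2 := by omega
    set c : Fin (n + 2) := ⟨k, hkn⟩ with hcdef
    refine ⟨g * G.σ c ((G.δ c.succ g)⁻¹ * z c), ?_, ?_⟩
    · rw [map_mul, hom_σ, map_mul, map_inv, hom_δ, hg, hz, inv_mul_cancel, map_one, mul_one]
    · intro i hi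
      rcases hi.eq_or_lt with hik | hik
      · have : i = c := Fin.ext hik.symm
        rw [this, map_mul, δσ_self G (Or.inr rfl), mul_inv_cancel_left]
      · have hi' := i.isLt
        -- As `k < i`, the indices `i = t + 1` and `k` can be typed as in the matching condition `hc`.
        obtain ⟨t, rfl⟩ : ∃ t : Fin (n + 1), i = t.succ :=
          ⟨⟨i - 1, by omega⟩, Fin.ext (by simp; omega)⟩
        obtain ⟨c', hcc⟩ : ∃ c' : Fin (n + 1), c = c'.castSucc := by
          rw [Fin.val_succ] at hi' hik
          exact ⟨⟨k, by omega⟩, Fin.ext rfl⟩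
        have hck : (c' : ℕ) = k := by
          have := congrArg Fin.val hcc
          exact this.symm
        rw [Fin.val_succ] at hik
        have hle : c' ≤ t := by rw [Fin.le_def]; omega
        rw [map_mul, hg' _ (by rw [Fin.val_succ]; omega), hcc,
          δσ_of_gt G (j' := t.succ) (i' := c') (by simp; omega) rfl rfl, map_mul, map_inv,
          hc _ _ hle]
        have : G.δ t.succ (G.δ c'.castSucc.succ g) = G.δ c'.succ (G.δ t.succ.succ g) := by
          rw [δδ_of_le G (i := c'.succ) (j := t.succ) (by simpa using hle)]
          rfl
        rw [this, hg' t.succ (by rw [Fin.val_succ]; omega), inv_mul_cancel, map_one, mul_one]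

open Classical in
/-- The extension of a pseudo-cross section by one dimension: on a degenerate simplex `s_i x` the
value is forced, on a nondegenerate simplex some lift with the prescribed faces `∂_i`, `i ≥ 1`, is
chosen. -/
noncomputable def extendSection {n : ℕ} (t : L _⦋n⦌ → G _⦋n⦌) (l : L _⦋n + 1⦌) :
    G _⦋n + 1⦌ :=
  if h : ∃ p : Fin (n + 1) × L _⦋n⦌, L.σ p.1 p.2 = l then
    G.σ h.choose.1 (t h.choose.2)
  else Classical.epsilon fun g : G _⦋n + 1⦌ ↦
    π.app (op ⦋n + 1⦌) g = l ∧ ∀ i : Fin (n + 1), G.δ i.succ g = t (L.δ i.succ l)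

theorem extendSection_σ {n : ℕ} {t : L _⦋n⦌ → G _⦋n⦌}
    (ht : ∀ (i j : Fin (n + 1)) (x y : L _⦋n⦌), L.σ i x = L.σ j y →
      G.σ i (t x) = G.σ j (t y)) (i : Fin (n + 1)) (x : L _⦋n⦌) :
    extendSection π t (L.σ i x) = G.σ i (t x) := by
  have h : ∃ p : Fin (n + 1) × L _⦋n⦌, L.σ p.1 p.2 = L.σ i x := ⟨(i, x), rfl⟩
  rw [extendSection, dif_pos h]
  exact ht _ _ _ _ h.choose_spec

theorem extendSection_spec {n : ℕ} {t : L _⦋n⦌ → G _⦋n⦌}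
    (ht : ∀ (i j : Fin (n + 1)) (x y : L _⦋n⦌), L.σ i x = L.σ j y →
      G.σ i (t x) = G.σ j (t y))
    (hp : ∀ x, π.app (op ⦋n⦌) (t x) = x)
    (hδσ : ∀ (i j : Fin (n + 1)) (x : L _⦋n⦌),
      G.δ j.succ (G.σ i (t x)) = t (L.δ j.succ (L.σ i x)))
    (hex : ∀ l : L _⦋n + 1⦌, ∃ g : G _⦋n + 1⦌,
      π.app (op ⦋n + 1⦌) g = l ∧ ∀ i : Fin (n + 1), G.δ i.succ g = t (L.δ i.succ l))
    (l : L _⦋n + 1⦌) :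
    π.app (op ⦋n + 1⦌) (extendSection π t l) = l ∧
      ∀ i : Fin (n + 1), G.δ i.succ (extendSection π t l) = t (L.δ i.succ l) := by
  by_cases h : ∃ p : Fin (n + 1) × L _⦋n⦌, L.σ p.1 p.2 = l
  · obtain ⟨⟨i, x⟩, rfl⟩ := h
    rw [extendSection_σ π ht]
    exact ⟨by rw [hom_σ, hp], fun j ↦ hδσ i j x⟩
  · rw [extendSection, dif_neg h]
    exact Classical.epsilon_spec (hex l)

open Classical in
/-- A normalized pseudo-cross section of a surjection of simplicial groups, built by recursion on
the dimension. -/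
noncomputable def crossSection (hπ : ∀ Δ, Function.Surjective (π.app Δ))
    (n : ℕ) : L _⦋n⦌ → G _⦋n⦌ :=
  match n with
  | 0 => fun l ↦ if l = 1 then 1 else (hπ (op ⦋0⦌) l).choose
  | n + 1 => extendSection π (crossSection hπ n)

theorem crossSection_proj_zero (hπ : ∀ Δ, Function.Surjective (π.app Δ)) (l : L _⦋0⦌) :
    π.app (op ⦋0⦌) (crossSection π hπ 0 l) = l := by
  unfold crossSection
  dsimp only
  split_ifs with h
  · rw [map_one, h]
  · exact (hπ (op ⦋0⦌) l).choose_spec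

/-- In degree `n`, `crossSection` is a section whose degeneracies and faces `∂_i`, `i ≥ 1`, are as
required of a pseudo-cross section, up to degree `n + 1`. -/
theorem crossSection_spec (hπ : ∀ Δ, Function.Surjective (π.app Δ)) (n : ℕ) :
    (∀ l, π.app (op ⦋n⦌) (crossSection π hπ n l) = l) ∧
    (∀ (i : Fin (n + 1)) (l : L _⦋n⦌),
      G.σ i (crossSection π hπ n l) = crossSection π hπ (n + 1) (L.σ i l)) ∧
    (∀ l : L _⦋n + 1⦌, π.app (op ⦋n + 1⦌) (crossSection π hπ (n + 1) l) = l ∧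
      ∀ i : Fin (n + 1), G.δ i.succ (crossSection π hπ (n + 1) l) =
        crossSection π hπ n (L.δ i.succ l)) := by
  induction n with
  | zero =>
    have ht : ∀ (i j : Fin (0 + 1)) (x y : L _⦋0⦌), L.σ i x = L.σ j y →
        G.σ i (crossSection π hπ 0 x) = G.σ j (crossSection π hπ 0 y) := by
      intro i j x y h
      obtain rfl : i = j := Subsingleton.elim (α := Fin 1) _ _
      rw [σ_injective L i h]
    refine ⟨crossSection_proj_zero π hπ, fun i l ↦ (extendSection_σ π ht i l).symm,
      extendSection_spec π ht (crossSection_proj_zero π hπ) ?_ ?_⟩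
    · intro i j x
      have hij : ((j.succ : Fin (0 + 2)) : ℕ) = i + 1 := by
        have := i.isLt; have := j.isLt; rw [Fin.val_succ]; omega
      rw [δσ_self G (Or.inr hij), δσ_self L (Or.inr hij)]
    · intro l
      obtain ⟨g, hg⟩ := hπ _ l
      refine ⟨g * G.σ 0 ((G.δ 1 g)⁻¹ * crossSection π hπ 0 (L.δ 1 l)), ?_, ?_⟩
      · rw [map_mul, hom_σ, map_mul, map_inv, hom_δ, hg, crossSection_proj_zero, inv_mul_cancel,
          map_one, mul_one]
      · intro i
        obtain rfl : i = 0 := Subsingleton.elim (α := Fin 1) _ _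
        change G.δ 1 _ = crossSection π hπ 0 (L.δ 1 l)
        rw [map_mul, δσ_self G (Or.inr rfl), mul_inv_cancel_left]
  | succ n ih =>
    obtain ⟨-, ihσ, ihδ⟩ := ih
    have hlt : ∀ (i j : Fin (n + 2)) (x y : L _⦋n + 1⦌), i < j → L.σ i x = L.σ j y →
        G.σ i (crossSection π hπ (n + 1) x) = G.σ j (crossSection π hπ (n + 1) y) := by
      intro i j x y hij h
      obtain ⟨i', j', w, hi, hj, rfl, rfl⟩ := exists_of_σ_eq_σ L hij h
      rw [← ihσ, ← ihσ, σσ_of_lt G hij hi hj]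
    have ht : ∀ (i j : Fin (n + 1 + 1)) (x y : L _⦋n + 1⦌), L.σ i x = L.σ j y →
        G.σ i (crossSection π hπ (n + 1) x) = G.σ j (crossSection π hπ (n + 1) y) := by
      intro i j x y h
      rcases lt_trichotomy i j with hij | rfl | hij
      · exact hlt i j x y hij h
      · rw [σ_injective L i h]
      · exact (hlt j i y x hij h.symm).symm
    refine ⟨fun l ↦ (ihδ l).1, fun i l ↦ (extendSection_σ π ht i l).symm,
      extendSection_spec π ht (fun l ↦ (ihδ l).1) ?_ ?_⟩
    · intro i j x
      have hi := i.isLt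
      have hj := j.isLt
      rcases lt_trichotomy ((j : ℕ) + 1) i with h | h | h
      · have e1 : ((⟨j, by omega⟩ : Fin (n + 1)).succ : ℕ) = (j.succ : ℕ) := by simp
        have e2 : ((⟨i - 1, by omega⟩ : Fin (n + 1)) : ℕ) + 1 = i := by simp; omega
        rw [δσ_of_lt G (by simpa using h) e1 e2, δσ_of_lt L (by simpa using h) e1 e2,
          (ihδ x).2, ihσ]
      · rw [δσ_self G (Or.inl (by simpa using h)), δσ_self L (Or.inl (by simpa using h))]
      · rcases (Nat.lt_succ_iff.mp h).eq_or_lt with h | h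
        · rw [δσ_self G (Or.inr (by simp [h])), δσ_self L (Or.inr (by simp [h]))]
        · have e1 : ((⟨j - 1, by omega⟩ : Fin (n + 1)).succ : ℕ) + 1 = (j.succ : ℕ) := by
            simp; omega
          have e2 : ((⟨i, by omega⟩ : Fin (n + 1)) : ℕ) = i := rfl
          rw [δσ_of_gt G (by simpa using h) e1 e2, δσ_of_gt L (by simpa using h) e1 e2,
            (ihδ x).2, ihσ]
    · intro l
      refine exists_lift_of_horn π hπ l (fun i ↦ crossSection π hπ (n + 1) (L.δ i.succ l))
        (fun i ↦ (ihδ _).1) ?_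
      intro k i hki
      rw [(ihδ _).2, (ihδ _).2, δδ_of_le L (i := k.succ) (j := i.succ) (by simpa using hki)]
      rfl

/-- Every surjection of simplicial groups has a normalized pseudo-cross section. -/
theorem exists_isPseudoCrossSection (hπ : ∀ Δ, Function.Surjective (π.app Δ)) :
    ∃ s : ∀ n : ℕ, L _⦋n⦌ → G _⦋n⦌, IsPseudoCrossSection π s ∧ ∀ n, s n 1 = 1 := by
  refine ⟨crossSection π hπ, ⟨fun n ↦ (crossSection_spec π hπ n).1,
    fun n i l ↦ ((crossSection_spec π hπ n).2.2 l).2 i,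
    fun n ↦ (crossSection_spec π hπ n).2.1⟩, fun n ↦ ?_⟩
  induction n with
  | zero => exact if_pos rfl
  | succ n ih =>
    -- In positive degrees the identity is `s₀ 1`.
    have h := (crossSection_spec π hπ n).2.1 0 1
    rw [ih, map_one, map_one] at h
    exact h.symm

end CrossSection

/-! ### Pseudo-cross sections and operators preserving the initial vertex -/

/-- A pseudo-cross section commutes with every operator that fixes the initial vertex. -/
theorem IsPseudoCrossSection.map_of_zero {G L : SimplicialObject GrpCat.{u}} {π : G ⟶ L}
    {s : ∀ n : ℕ, L _⦋n⦌ → G _⦋n⦌} (hs : IsPseudoCrossSection π s) {m n : ℕ}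
    (α : ⦋m⦌ ⟶ ⦋n⦌) (h : α.toOrderHom (0 : Fin (m + 1)) = (0 : Fin (n + 1))) (x : L _⦋n⦌) :
    G.map α.op (s n x) = s m (L.map α.op x) := by
  -- The cones `conePlus β` form a functor, so the generators `δ i`, `σ i` suffice for them.
  let W : MorphismProperty SimplexCategory := fun a b β ↦ ∀ y : L _⦋b.len + 1⦌,
    G.map (conePlus β).op (s (b.len + 1) y) = s (a.len + 1) (L.map (conePlus β).op y)
  have : W.IsMultiplicative :=
    { id_mem := by
        intro a y
        rw [conePlus_id, grp_map_id_apply, grp_map_id_apply]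
      comp_mem := by
        intro a b c β α hβ hα y
        rw [conePlus_comp, ← grp_map_map_apply, ← grp_map_map_apply, hα, hβ] }
  have hW : W = ⊤ := by
    apply SimplexCategory.morphismProperty_eq_top
    · intro n i y
      rw [conePlus_δ]
      exact hs.δ_succ (n + 1) i y
    · intro n i y
      rw [conePlus_σ]
      exact hs.σ_eq (n + 1) i.succ y
  have hcone : W α := by rw [hW]; trivial
  -- For `α` fixing `0`, `s₀ α^* = (conePlus α)^* s₀`, and `s₀` is injective.
  have key : SimplexCategory.σ (0 : Fin (m + 1)) ≫ α =
      conePlus α ≫ SimplexCategory.σ (0 : Fin (n + 1)) :=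
    (coneZero_of_zero α h).symm.trans (coneZero_eq α)
  apply σ_injective G (0 : Fin (m + 1))
  rw [hs.σ_eq]
  change G.map (SimplexCategory.σ (0 : Fin (m + 1))).op _ =
    s (m + 1) (L.map (SimplexCategory.σ (0 : Fin (m + 1))).op _)
  rw [grp_map_map_apply, grp_map_map_apply, key, ← grp_map_map_apply, ← grp_map_map_apply]
  refine Eq.trans ?_ (hcone (L.σ 0 x))
  exact congrArg _ (hs.σ_eq n 0 x)

theorem revHom_zero {a b : SimplexCategory} (α : a ⟶ b) (i : ℕ) :
    (revHom α i).toOrderHom (0 : Fin (i + 1)) = (0 : Fin (revVal α i + 1)) := by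
  apply Fin.ext
  change (α.toOrderHom (⟨a.len - (i - 0), by omega⟩ : Fin (a.len + 1)) : Fin (b.len + 1)).val -
    (α.toOrderHom (⟨a.len - i, by omega⟩ : Fin (a.len + 1)) : Fin (b.len + 1)).val = 0
  rw [Nat.sub_eq_zero_iff_le]
  exact (toOrderHom_congr α _ (by omega)).le

/-! ### Gauge transformations of bars -/

section Gauge

variable {G L : SimplicialObject GrpCat.{u}}

theorem lastHom_succ (i : ℕ) : lastHom (i + 1) i = SimplexCategory.δ (0 : Fin (i + 2)) := by
  apply hom_ext_fin
  rintro ⟨k, hk⟩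
  apply Fin.ext
  change k < i + 1 at hk
  refine Eq.trans ?_ (δ_val (n := i) 0 k hk).symm
  change (i + 1 : ℕ) - (i - k) = if k < 0 then k else k + 1
  split_ifs <;> omega

/-- The right action of a family `u` of elements `u_i ∈ G_i` on bars: the entry `g_i` is replaced by
`(∂₀ u_{i+1})⁻¹ g_i u_i`. Only `u_0, …, u_n` matter for bars of length `n`. -/
def Bar.gauge {n : ℕ} (g : Bar G n) (u : ∀ i : ℕ, G _⦋i⦌) : Bar G n :=
  fun i ↦ (G.δ 0 (u (i + 1)))⁻¹ * g i * u i

theorem Bar.gauge_one {n : ℕ} (g : Bar G n) : g.gauge 1 = g := by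
  funext i
  change (G.δ 0 (1 : G _⦋(i : ℕ) + 1⦌))⁻¹ * g i * 1 = g i
  rw [map_one, inv_one, one_mul, mul_one]

theorem Bar.gauge_mul {n : ℕ} (g : Bar G n) (u v : ∀ i : ℕ, G _⦋i⦌) :
    g.gauge (u * v) = (g.gauge u).gauge v := by
  funext i
  change (G.δ 0 (u (i + 1) * v (i + 1)))⁻¹ * g i * (u i * v i) =
    (G.δ 0 (v (i + 1)))⁻¹ * ((G.δ 0 (u (i + 1)))⁻¹ * g i * u i) * v i
  rw [map_mul, mul_inv_rev]
  simp only [mul_assoc]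

theorem Bar.gauge_congr {n : ℕ} (g : Bar G n) {u v : ∀ i : ℕ, G _⦋i⦌}
    (h : ∀ i ≤ n, u i = v i) : g.gauge u = g.gauge v := by
  funext i
  have hi := i.isLt
  unfold Bar.gauge
  rw [h i (by omega), h (i + 1) (by omega)]

theorem Bar.prod_gauge {n : ℕ} (g : Bar G n) (u : ∀ i : ℕ, G _⦋i⦌) {q a : ℕ} (h : q ≤ a)
    (ha : a ≤ n) :
    (g.gauge u).prod q a = (G.map (lastHom a q).op (u a))⁻¹ * g.prod q a * u q := by
  induction a, h using Nat.le_induction with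
  | base =>
    rw [Bar.prod_of_le _ le_rfl, Bar.prod_of_le _ le_rfl, lastHom_self, grp_map_id_apply, mul_one,
      inv_mul_cancel]
  | succ a h ih =>
    have hget : (g.gauge u).get a = (G.δ 0 (u (a + 1)))⁻¹ * g.get a * u a := by
      rw [Bar.get, dif_pos (by omega), Bar.get, dif_pos (by omega)]
      rfl
    have hδ : G.map (lastHom a q).op (G.δ 0 (u (a + 1))) =
        G.map (lastHom (a + 1) q).op (u (a + 1)) := by
      refine (grp_map_map_apply G (lastHom a q) (SimplexCategory.δ 0) _).trans ?_
      rw [← lastHom_succ, lastHom_comp h (Nat.le_succ a)]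
    rw [Bar.prod_succ _ h, Bar.prod_succ _ h, ih (by omega), hget, map_mul, map_mul, map_inv, hδ]
    group

/-- Simplicial operators on bars are compatible with gauge transformations. -/
theorem Bar.map_gauge {a b : SimplexCategory} (α : a ⟶ b) (g : Bar G b.len)
    (u : ∀ i : ℕ, G _⦋i⦌) :
    (g.gauge u).map α =
      (g.map α).gauge fun i ↦ G.map (revHom α i).op (u (revVal α i)) := by
  funext i
  have hi := i.isLt
  change G.map (revHom α i).op ((g.gauge u).prod (revVal α i) (revVal α (i + 1))) =
    (G.δ 0 (G.map (revHom α (i + 1)).op (u (revVal α (i + 1)))))⁻¹ *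
      G.map (revHom α i).op (g.prod (revVal α i) (revVal α (i + 1))) *
      G.map (revHom α i).op (u (revVal α i))
  have hδ : G.δ 0 (G.map (revHom α (i + 1)).op (u (revVal α (i + 1)))) =
      G.map (revHom α i).op (G.map (lastHom (revVal α (i + 1)) (revVal α i)).op
        (u (revVal α (i + 1)))) := by
    refine (grp_map_map_apply G (SimplexCategory.δ 0) (revHom α (i + 1)) _).trans ?_
    rw [grp_map_map_apply, ← lastHom_revHom α (Nat.le_succ i) (by omega), lastHom_succ]
  rw [Bar.prod_gauge _ _ (revVal_mono α (Nat.le_succ i)) (revVal_le α _), hδ, map_mul, map_mul,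
    map_inv]

theorem Bar.mapHom_gauge (π : G ⟶ L) {n : ℕ} (g : Bar G n) (u : ∀ i : ℕ, G _⦋i⦌) :
    (g.gauge u).mapHom π = (g.mapHom π).gauge fun i ↦ π.app (op ⦋i⦌) (u i) := by
  funext i
  change π.app _ ((G.δ 0 (u (i + 1)))⁻¹ * g i * u i) =
    (L.δ 0 (π.app _ (u (i + 1))))⁻¹ * π.app _ (g i) * π.app _ (u i)
  rw [map_mul, map_mul, map_inv, hom_δ]

theorem Bar.mapHom_map (π : G ⟶ L) {a b : SimplexCategory} (α : a ⟶ b) (g : Bar G b.len) :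
    (g.map α).mapHom π = (g.mapHom π).map α := by
  funext i
  change π.app _ (G.map _ _) = L.map _ _
  rw [hom_grp_map_apply, Bar.prod_mapHom]

/-- A bar is the gauge transform of the trivial bar by its partial products. -/
theorem Bar.one_gauge_prod {m n a : ℕ} (g : Bar G m) (h : n ≤ a) :
    (1 : Bar G n).gauge (fun i ↦ g.prod i a) = fun i : Fin n ↦ g.get i := by
  funext i
  have hi := i.isLt
  change (G.δ 0 (g.prod (i + 1) a))⁻¹ * 1 * g.prod i a = g.get i
  rw [g.prod_mul (Nat.le_succ i) (show (i : ℕ) + 1 ≤ a by omega), g.prod_self_succ,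
    lastHom_succ, mul_one]
  exact inv_mul_cancel_left _ _

theorem Bar.get_eq {n : ℕ} (g : Bar G n) : (fun i : Fin n ↦ g.get i) = g := by
  funext i
  exact dif_pos i.isLt

end Gauge

/-! ### Bars in the kernel -/

section Kernel

variable {K G L : SimplicialObject GrpCat.{u}} {ι : K ⟶ G} {π : G ⟶ L}

theorem IsShortExact.mapHom_injective (hex : IsShortExact ι π) {n : ℕ} :
    Function.Injective (Bar.mapHom ι : Bar K n → Bar G n) := fun _ _ h ↦
  funext fun i ↦ hex.injective _ (congrFun h i)

theorem IsShortExact.mapHom_mapHom (hex : IsShortExact ι π) {n : ℕ} (k : Bar K n) :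
    (k.mapHom ι).mapHom π = 1 := by
  funext i
  have h : ι.app (op ⦋(i : ℕ)⦌) (k i) ∈ (π.app (op ⦋(i : ℕ)⦌)).hom.ker := by
    rw [← hex.range_eq_ker]
    exact ⟨k i, rfl⟩
  exact h

theorem IsShortExact.exists_mapHom_eq (hex : IsShortExact ι π) {n : ℕ} (g : Bar G n)
    (hg : g.mapHom π = 1) : ∃ k : Bar K n, k.mapHom ι = g := by
  have h : ∀ i : Fin n, ∃ x : K _⦋(i : ℕ)⦌, ι.app (op ⦋(i : ℕ)⦌) x = g i := by
    intro i
    have h : g i ∈ (π.app (op ⦋(i : ℕ)⦌)).hom.ker := congrFun hg i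
    rw [← hex.range_eq_ker] at h
    exact h
  choose k hk using h
  exact ⟨k, funext hk⟩

/-- The bar in `BK` with a given image in `BG`. -/
noncomputable def IsShortExact.lift (hex : IsShortExact ι π) {n : ℕ} (g : Bar G n)
    (hg : g.mapHom π = 1) : Bar K n :=
  (hex.exists_mapHom_eq g hg).choose

theorem IsShortExact.mapHom_lift (hex : IsShortExact ι π) {n : ℕ} (g : Bar G n)
    (hg : g.mapHom π = 1) : (hex.lift g hg).mapHom ι = g :=
  (hex.exists_mapHom_eq g hg).choose_spec

theorem IsShortExact.mapHom_gauge_eq_one (hex : IsShortExact ι π) {n : ℕ} {u : ∀ i : ℕ, G _⦋i⦌}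
    (hu : (1 : Bar L n).gauge (fun i ↦ π.app (op ⦋i⦌) (u i)) = 1) (k : Bar K n) :
    ((k.mapHom ι).gauge u).mapHom π = 1 := by
  rw [Bar.mapHom_gauge, hex.mapHom_mapHom, hu]

theorem Bar.one_gauge_inv {n : ℕ} {u : ∀ i : ℕ, G _⦋i⦌}
    (hu : (1 : Bar L n).gauge (fun i ↦ π.app (op ⦋i⦌) (u i)) = 1) :
    (1 : Bar L n).gauge (fun i ↦ π.app (op ⦋i⦌) (u⁻¹ i)) = 1 := by
  nth_rewrite 1 [← hu]
  rw [← Bar.gauge_mul]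
  refine Eq.trans (Bar.gauge_congr _ fun i _ ↦ ?_) (Bar.gauge_one _)
  change π.app _ (u i) * π.app _ (u i)⁻¹ = 1
  rw [map_inv, mul_inv_cancel]

/-- The permutation of `BK` in degree `n` given by a gauge transformation of `BG` whose image in
`BL` fixes the trivial bar. -/
noncomputable def IsShortExact.gaugePerm (hex : IsShortExact ι π) {n : ℕ} (u : ∀ i : ℕ, G _⦋i⦌)
    (hu : (1 : Bar L n).gauge (fun i ↦ π.app (op ⦋i⦌) (u i)) = 1) : Equiv.Perm (Bar K n) where
  toFun k := hex.lift ((k.mapHom ι).gauge u) (hex.mapHom_gauge_eq_one hu k)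
  invFun k := hex.lift ((k.mapHom ι).gauge u⁻¹)
    (hex.mapHom_gauge_eq_one (Bar.one_gauge_inv hu) k)
  left_inv k := by
    apply hex.mapHom_injective
    refine (hex.mapHom_lift _ (hex.mapHom_gauge_eq_one (Bar.one_gauge_inv hu) _)).trans ?_
    rw [hex.mapHom_lift, ← Bar.gauge_mul, mul_inv_cancel, Bar.gauge_one]
  right_inv k := by
    apply hex.mapHom_injective
    refine (hex.mapHom_lift _ (hex.mapHom_gauge_eq_one hu _)).trans ?_
    rw [hex.mapHom_lift, ← Bar.gauge_mul, inv_mul_cancel, Bar.gauge_one]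

theorem IsShortExact.mapHom_gaugePerm (hex : IsShortExact ι π) {n : ℕ} (u : ∀ i : ℕ, G _⦋i⦌)
    (hu : (1 : Bar L n).gauge (fun i ↦ π.app (op ⦋i⦌) (u i)) = 1) (k : Bar K n) :
    (hex.gaugePerm u hu k).mapHom ι = (k.mapHom ι).gauge u :=
  hex.mapHom_lift _ (hex.mapHom_gauge_eq_one hu k)

end Kernel

/-! ### The gauge transformations of a pseudo-cross section -/

section Cone

variable {L : SimplicialObject GrpCat.{u}} {a b c : SimplexCategory} {α : a ⟶ b}
  {γ : ⦋a.len + 1⦌ ⟶ c} {e : ℕ}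

theorem revVal_cone (hc : c.len = b.len + e)
    (hγ : ∀ k : Fin (a.len + 1), (γ.toOrderHom k.succ : Fin (c.len + 1)).val =
      (α.toOrderHom k : Fin (b.len + 1)).val + e) {i : ℕ} (hi : i ≤ a.len) :
    revVal γ i = revVal α i := by
  have h := hγ ⟨a.len - i, by omega⟩
  change c.len - (γ.toOrderHom (⟨a.len + 1 - i, by omega⟩ : Fin (a.len + 2)) :
    Fin (c.len + 1)).val = b.len - _
  rw [toOrderHom_congr γ _ (show a.len + 1 - i = a.len - i + 1 by omega)]
  change c.len - (γ.toOrderHom (Fin.succ (⟨a.len - i, by omega⟩ : Fin (a.len + 1))) :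
    Fin (c.len + 1)).val = _
  rw [h]
  omega

/-- The partial products of `γ^* y`, where `γ` extends `α` (up to a shift of the target) by a new
initial vertex. -/
theorem Bar.prod_map_cone (hc : c.len = b.len + e)
    (hγ : ∀ k : Fin (a.len + 1), (γ.toOrderHom k.succ : Fin (c.len + 1)).val =
      (α.toOrderHom k : Fin (b.len + 1)).val + e) (y : Bar L c.len) {q i : ℕ} (hq : q ≤ a.len)
    (hqi : q ≤ i) (hi : i ≤ a.len + 1) :
    (y.map γ).prod q i = L.map (revHom α q).op (y.prod (revVal α q) (revVal γ i)) := by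
  rw [y.prod_map γ hqi hi]
  refine y.map_prod_congr (revVal_cone hc hγ hq) rfl _ _ fun k ↦ ?_
  have h1 := hγ ⟨a.len - (q - k), by omega⟩
  have h2 := hγ ⟨a.len - q, by omega⟩
  change (γ.toOrderHom (⟨a.len + 1 - (q - k), by omega⟩ : Fin (a.len + 2)) :
    Fin (c.len + 1)).val - (γ.toOrderHom (⟨a.len + 1 - q, by omega⟩ : Fin (a.len + 2)) :
    Fin (c.len + 1)).val = (α.toOrderHom (⟨a.len - (q - k), by omega⟩ : Fin (a.len + 1)) :
    Fin (b.len + 1)).val - (α.toOrderHom (⟨a.len - q, by omega⟩ : Fin (a.len + 1)) :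
    Fin (b.len + 1)).val
  rw [toOrderHom_congr γ _ (show a.len + 1 - (q - k) = a.len - (q - k) + 1 by omega),
    toOrderHom_congr γ _ (show a.len + 1 - q = a.len - q + 1 by omega)]
  change (γ.toOrderHom (Fin.succ (⟨a.len - (q - k), by omega⟩ : Fin (a.len + 1))) :
    Fin (c.len + 1)).val - (γ.toOrderHom (Fin.succ (⟨a.len - q, by omega⟩ : Fin (a.len + 1))) :
    Fin (c.len + 1)).val = _
  rw [h1, h2]
  omega

end Cone

section SectionGauge

variable {G L : SimplicialObject GrpCat.{u}} {π : G ⟶ L} (s : ∀ n : ℕ, L _⦋n⦌ → G _⦋n⦌)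

/-- The family `σ(l_{(n,i)})` attached to `l = [l_{n-1} | … | l_0]`. -/
def sectionGauge {n : ℕ} (l : Bar L n) (i : ℕ) : G _⦋i⦌ := s i (l.prod i n)

/-- The family `σ(l_{(n+1,i)}) σ(l_{(n,i)})⁻¹` attached to `l = [l_n | … | l_0]`. It is the gauge
transformation by which the generator `[l]` of `ΩBL` acts on `BK`. -/
def loopGauge {n : ℕ} (l : Bar L (n + 1)) (i : ℕ) : G _⦋i⦌ :=
  s i (l.prod i (n + 1)) * (s i (l.prod i n))⁻¹

variable {s}

theorem IsPseudoCrossSection.section_prod_map_cone (hs : IsPseudoCrossSection π s)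
    {a b c : SimplexCategory} {α : a ⟶ b} {γ : ⦋a.len + 1⦌ ⟶ c} {e : ℕ} (hc : c.len = b.len + e)
    (hγ : ∀ k : Fin (a.len + 1), (γ.toOrderHom k.succ : Fin (c.len + 1)).val =
      (α.toOrderHom k : Fin (b.len + 1)).val + e) (y : Bar L c.len) {q i : ℕ} (hq : q ≤ a.len)
    (hqi : q ≤ i) (hi : i ≤ a.len + 1) :
    s q ((y.map γ).prod q i) =
      G.map (revHom α q).op (s _ (y.prod (revVal α q) (revVal γ i))) := by
  rw [Bar.prod_map_cone hc hγ y hq hqi hi, hs.map_of_zero _ (revHom_zero α q)]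

/-- The loop gauge of `γ^* y`, where `γ` extends `α` by a new initial vertex. -/
theorem IsPseudoCrossSection.loopGauge_map_cone (hs : IsPseudoCrossSection π s)
    {a b c : SimplexCategory} {α : a ⟶ b} {γ : ⦋a.len + 1⦌ ⟶ c} {e : ℕ} (hc : c.len = b.len + e)
    (hγ : ∀ k : Fin (a.len + 1), (γ.toOrderHom k.succ : Fin (c.len + 1)).val =
      (α.toOrderHom k : Fin (b.len + 1)).val + e) (y : Bar L c.len) {i m : ℕ} (hi : i ≤ a.len)
    (hm : revVal γ (a.len + 1) = m) :
    loopGauge s (y.map γ : Bar L (a.len + 1)) i =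
      G.map (revHom α i).op (s _ (y.prod (revVal α i) m)) *
        (G.map (revHom α i).op (s _ (y.prod (revVal α i) (revVal α a.len))))⁻¹ := by
  have h1 := hs.section_prod_map_cone hc hγ y hi (show i ≤ a.len + 1 by omega) le_rfl
  have h2 := hs.section_prod_map_cone hc hγ y hi hi (Nat.le_succ _)
  rw [hm] at h1
  rw [revVal_cone hc hγ le_rfl] at h2
  rw [← h1, ← h2]
  rfl

/-- The cocycle identity that makes the action of the generators of `ΩBL` compatible with the
simplicial operator `α^* [l] = [(coneOne α)^* l]⁻¹ [(conePlus α)^* l]`. -/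
theorem IsPseudoCrossSection.map_loopGauge_mul (hs : IsPseudoCrossSection π s)
    {a b : SimplexCategory} (α : a ⟶ b) (l : Bar L (b.len + 1)) {i : ℕ} (hi : i ≤ a.len) :
    G.map (revHom α i).op (loopGauge s l (revVal α i)) *
      loopGauge s (Bar.map (coneOne α) l : Bar L (a.len + 1)) i =
    loopGauge s (Bar.map (conePlus α) l : Bar L (a.len + 1)) i := by
  have h1 : revVal (coneOne α) (a.len + 1) = b.len := by
    change b.len + 1 - ((coneOne α).toOrderHom (⟨a.len + 1 - (a.len + 1), by omega⟩ :
      Fin (a.len + 2)) : Fin (b.len + 2)).val = b.len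
    rw [toOrderHom_congr (coneOne α) _ (Nat.sub_self _)]
    rfl
  have h2 : revVal (conePlus α) (a.len + 1) = b.len + 1 := by
    change b.len + 1 - ((conePlus α).toOrderHom (⟨a.len + 1 - (a.len + 1), by omega⟩ :
      Fin (a.len + 2)) : Fin (b.len + 2)).val = b.len + 1
    rw [toOrderHom_congr (conePlus α) _ (Nat.sub_self _)]
    rfl
  rw [hs.loopGauge_map_cone (α := α) (γ := coneOne α) (e := 1) rfl (fun _ ↦ rfl) l hi h1,
    hs.loopGauge_map_cone (α := α) (γ := conePlus α) (e := 1) rfl (fun _ ↦ rfl) l hi h2,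
    loopGauge, map_mul, map_inv]
  group

/-- The cocycle identity that makes `Ψ` simplicial: the twist of `α^*` is the generator
`[(coneZero α)^* l]`. -/
theorem IsPseudoCrossSection.map_sectionGauge_mul (hs : IsPseudoCrossSection π s)
    {a b : SimplexCategory} (α : a ⟶ b) (l : Bar L b.len) {i : ℕ} (hi : i ≤ a.len) :
    (G.map (revHom α i).op (sectionGauge s l (revVal α i)))⁻¹ *
      loopGauge s (Bar.map (coneZero α) l : Bar L (a.len + 1)) i =
    (sectionGauge s (Bar.map α l) i)⁻¹ := by
  have h1 : revVal (coneZero α) (a.len + 1) = b.len := by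
    change b.len - ((coneZero α).toOrderHom (⟨a.len + 1 - (a.len + 1), by omega⟩ :
      Fin (a.len + 2)) : Fin (b.len + 1)).val = b.len
    rw [toOrderHom_congr (coneZero α) _ (Nat.sub_self _)]
    rfl
  rw [hs.loopGauge_map_cone (α := α) (γ := coneZero α) (e := 0) rfl (fun _ ↦ rfl) l hi h1,
    sectionGauge, sectionGauge, l.prod_map α hi le_rfl,
    ← hs.map_of_zero _ (revHom_zero α i), inv_mul_cancel_left]

theorem IsPseudoCrossSection.one_gauge_loopGauge (hs : IsPseudoCrossSection π s) {n : ℕ}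
    (l : Bar L (n + 1)) :
    (1 : Bar L n).gauge (fun i ↦ π.app (op ⦋i⦌) (loopGauge s l i)) = 1 := by
  have h : (fun i ↦ π.app (op ⦋i⦌) (loopGauge s l i)) =
      (fun i ↦ l.prod i (n + 1)) * (fun i ↦ l.prod i n)⁻¹ := by
    funext i
    change π.app _ (s i (l.prod i (n + 1)) * (s i (l.prod i n))⁻¹) = _ * _
    rw [map_mul, map_inv, hs.proj, hs.proj]
    rfl
  rw [h, Bar.gauge_mul, Bar.one_gauge_prod l (Nat.le_succ n), ← Bar.one_gauge_prod l le_rfl,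
    ← Bar.gauge_mul, mul_inv_cancel, Bar.gauge_one]

theorem IsPseudoCrossSection.one_gauge_sectionGauge (hs : IsPseudoCrossSection π s) {n : ℕ}
    (l : Bar L n) :
    (1 : Bar L n).gauge (fun i ↦ π.app (op ⦋i⦌) (sectionGauge s l i)) = l := by
  refine Eq.trans (Bar.gauge_congr _ fun i _ ↦ hs.proj i _) ?_
  rw [Bar.one_gauge_prod l le_rfl, Bar.get_eq]

theorem IsPseudoCrossSection.gauge_sectionGauge_inv (hs : IsPseudoCrossSection π s) {n : ℕ}
    (l : Bar L n) :
    l.gauge (fun i ↦ π.app (op ⦋i⦌) ((sectionGauge s l)⁻¹ i)) = 1 := by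
  nth_rewrite 1 [← hs.one_gauge_sectionGauge l]
  rw [← Bar.gauge_mul]
  refine Eq.trans (Bar.gauge_congr _ fun i _ ↦ ?_) (Bar.gauge_one _)
  change π.app _ (sectionGauge s l i) * π.app _ (sectionGauge s l i)⁻¹ = 1
  rw [map_inv, mul_inv_cancel]

end SectionGauge

/-! ### The action of the loop group -/

section Action

variable {K G L : SimplicialObject GrpCat.{u}} {ι : K ⟶ G} {π : G ⟶ L}
  {s : ∀ n : ℕ, L _⦋n⦌ → G _⦋n⦌}

theorem Bar.prod_succ_of_get_eq_one {m n : ℕ} (z : Bar L m) (h : z.get n = 1) (i : ℕ) :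
    z.prod i (n + 1) = z.prod i n := by
  rw [Bar.prod, h, map_one, one_mul, ite_self]

theorem loopGauge_σ_zero {n : ℕ} (y : Bar L n) (i : ℕ) :
    loopGauge s ((classifyingSpace L).σ 0 y : Bar L (n + 1)) i = 1 := by
  have h : Bar.get ((classifyingSpace L).σ 0 y : Bar L (n + 1)) n = 1 :=
    (dif_pos (Nat.lt_succ_self n)).trans (classifyingSpace_σ_mid L n 0 y (Fin.last n) rfl)
  exact mul_inv_eq_one.mpr (congrArg (s i) (Bar.prod_succ_of_get_eq_one _ h i))

/-- The action of `ΩBL` on `BK` in degree `n`. -/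
noncomputable def loopActionHom (hex : IsShortExact ι π) (hs : IsPseudoCrossSection π s) (n : ℕ) :
    PresentedGroup (loopRels (classifyingSpace L) n) →* Equiv.Perm (Bar K n) :=
  PresentedGroup.toGroup
    (f := fun l : (classifyingSpace L) _⦋n + 1⦌ ↦
      hex.gaugePerm (n := n) (loopGauge s (n := n) l) (hs.one_gauge_loopGauge (n := n) l)) (by
    rintro _ ⟨y, rfl⟩
    rw [FreeGroup.lift_apply_of]
    ext k : 1
    apply hex.mapHom_injective
    rw [hex.mapHom_gaugePerm]
    exact (Bar.gauge_congr _ fun i _ ↦ loopGauge_σ_zero y i).trans (Bar.gauge_one _))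

theorem mapHom_loopActionHom_of (hex : IsShortExact ι π) (hs : IsPseudoCrossSection π s) (n : ℕ)
    (l : Bar L (n + 1)) (k : Bar K n) :
    (loopActionHom hex hs n (loopOf (classifyingSpace L) n l) k).mapHom ι =
      (k.mapHom ι).gauge (loopGauge s l) := by
  have h : loopActionHom hex hs n (loopOf (classifyingSpace L) n l) =
      hex.gaugePerm (loopGauge s l) (hs.one_gauge_loopGauge l) := PresentedGroup.toGroup.of _
  rw [h, hex.mapHom_gaugePerm]

theorem loopActionHom_map_of (hex : IsShortExact ι π) (hs : IsPseudoCrossSection π s)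
    {a b : SimplexCategory} (α : a ⟶ b) (l : Bar L (b.len + 1)) (k : Bar K b.len) :
    (loopActionHom hex hs b.len (loopOf (classifyingSpace L) b.len l) k).map α =
      loopActionHom hex hs a.len (loopMap (classifyingSpace L) α
        (loopOf (classifyingSpace L) b.len l)) (k.map α) := by
  have h0 := loopMap_of (classifyingSpace L) α l
  rw [h0, map_mul, map_inv, Equiv.Perm.mul_apply, eq_comm, Equiv.Perm.inv_eq_iff_eq]
  apply hex.mapHom_injective
  have h1 := mapHom_loopActionHom_of hex hs a.len (Bar.map (coneOne α) l)
    ((loopActionHom hex hs b.len (loopOf (classifyingSpace L) b.len l) k).map α)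
  have h2 := mapHom_loopActionHom_of hex hs a.len (Bar.map (conePlus α) l) (k.map α)
  refine h2.trans (Eq.trans ?_ h1.symm)
  have h3 := mapHom_loopActionHom_of hex hs b.len l k
  rw [Bar.mapHom_map, Bar.mapHom_map, h3, Bar.map_gauge, ← Bar.gauge_mul]
  exact Bar.gauge_congr _ fun i hi ↦ (hs.map_loopGauge_mul α l hi).symm

theorem loopActionHom_map (hex : IsShortExact ι π) (hs : IsPseudoCrossSection π s)
    {a b : SimplexCategory} (α : a ⟶ b)
    (g : PresentedGroup (loopRels (classifyingSpace L) b.len)) (k : Bar K b.len) :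
    (loopActionHom hex hs b.len g k).map α =
      loopActionHom hex hs a.len (loopMap (classifyingSpace L) α g) (k.map α) := by
  have hg : g ∈ Subgroup.closure (Set.range (PresentedGroup.of
      (rels := loopRels (classifyingSpace L) b.len))) := by
    rw [PresentedGroup.closure_range_of]
    trivial
  induction hg using Subgroup.closure_induction generalizing k with
  | mem g hg =>
    obtain ⟨l, rfl⟩ := hg
    exact loopActionHom_map_of hex hs α l k
  | one => rw [map_one, map_one, map_one]; rfl
  | mul g h _ _ ihg ihh =>
    rw [map_mul, map_mul, map_mul, Equiv.Perm.mul_apply, Equiv.Perm.mul_apply, ihg, ihh]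
  | inv g _ ih =>
    rw [map_inv, map_inv, map_inv, eq_comm, Equiv.Perm.inv_eq_iff_eq, ← ih,
      ← Equiv.Perm.mul_apply, mul_inv_cancel, Equiv.Perm.one_apply]

/-- The action of the loop group `ΩBL` on `BK` determined by a pseudo-cross section. -/
noncomputable def loopAction (hex : IsShortExact ι π) (hs : IsPseudoCrossSection π s) :
    SimplicialAction (loopGroup (classifyingSpace L)) (classifyingSpace K) where
  smul Δ g x := loopActionHom hex hs Δ.unop.len g x
  one_smul Δ x := by
    refine (congrArg (fun p : Equiv.Perm (Bar K Δ.unop.len) ↦ p x)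
      (map_one (loopActionHom hex hs Δ.unop.len))).trans rfl
  mul_smul Δ g h x := by
    refine (congrArg (fun p : Equiv.Perm (Bar K Δ.unop.len) ↦ p x)
      (map_mul (loopActionHom hex hs Δ.unop.len) g h)).trans rfl
  map_smul f g x := loopActionHom_map hex hs f.unop g x

theorem mapHom_loopAction_smul (hex : IsShortExact ι π) (hs : IsPseudoCrossSection π s) (n : ℕ)
    (l : Bar L (n + 1)) (k : Bar K n) :
    Bar.mapHom ι ((loopAction hex hs).smul (op ⦋n⦌) (loopGen (classifyingSpace L) n l) k) =
      (k.mapHom ι).gauge (loopGauge s l) :=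
  mapHom_loopActionHom_of hex hs n l k

end Action

/-! ### The isomorphism `Ψ` -/

section Psi

variable {K G L : SimplicialObject GrpCat.{u}} {ι : K ⟶ G} {π : G ⟶ L}
  {s : ∀ n : ℕ, L _⦋n⦌ → G _⦋n⦌}

theorem IsPseudoCrossSection.mapHom_gauge_sectionGauge_inv (hs : IsPseudoCrossSection π s) {n : ℕ}
    (g : Bar G n) : (g.gauge (sectionGauge s (g.mapHom π))⁻¹).mapHom π = 1 := by
  rw [Bar.mapHom_gauge, hs.gauge_sectionGauge_inv]

/-- The `BK`-component of `Ψ`. On partial products it is `P ↦ P σ(π P)⁻¹` if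
`σ` is normalized. -/
noncomputable def psiFibre (hex : IsShortExact ι π) (hs : IsPseudoCrossSection π s) {n : ℕ}
    (g : Bar G n) : Bar K n :=
  hex.lift (g.gauge (sectionGauge s (g.mapHom π))⁻¹) (hs.mapHom_gauge_sectionGauge_inv g)

theorem mapHom_psiFibre (hex : IsShortExact ι π) (hs : IsPseudoCrossSection π s) {n : ℕ}
    (g : Bar G n) :
    (psiFibre hex hs g).mapHom ι = g.gauge (sectionGauge s (g.mapHom π))⁻¹ :=
  hex.mapHom_lift _ (hs.mapHom_gauge_sectionGauge_inv g)

/-- `Ψ` in degree `n`. -/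
noncomputable def psiEquiv (hex : IsShortExact ι π) (hs : IsPseudoCrossSection π s) (n : ℕ) :
    Bar G n ≃ Bar K n × Bar L n where
  toFun g := (psiFibre hex hs g, g.mapHom π)
  invFun p := (p.1.mapHom ι).gauge (sectionGauge s p.2)
  left_inv g := by
    change ((psiFibre hex hs g).mapHom ι).gauge (sectionGauge s (g.mapHom π)) = g
    rw [mapHom_psiFibre, ← Bar.gauge_mul, inv_mul_cancel, Bar.gauge_one]
  right_inv p := by
    have h : ((p.1.mapHom ι).gauge (sectionGauge s p.2)).mapHom π = p.2 := by
      rw [Bar.mapHom_gauge, hex.mapHom_mapHom, hs.one_gauge_sectionGauge]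
    refine Prod.ext (hex.mapHom_injective ?_) h
    change (psiFibre hex hs _).mapHom ι = _
    rw [mapHom_psiFibre, h, ← Bar.gauge_mul, mul_inv_cancel, Bar.gauge_one]

theorem psiFibre_map (hex : IsShortExact ι π) (hs : IsPseudoCrossSection π s)
    {a b : SimplexCategory} (α : a ⟶ b) (g : Bar G b.len) :
    psiFibre hex hs (g.map α) =
      loopActionHom hex hs a.len (loopOf (classifyingSpace L) a.len
        (Bar.map (coneZero α) (g.mapHom π))) ((psiFibre hex hs g).map α) := by
  apply hex.mapHom_injective
  rw [mapHom_psiFibre]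
  refine Eq.trans ?_ (mapHom_loopActionHom_of hex hs a.len _ _).symm
  rw [Bar.mapHom_map, Bar.mapHom_map, mapHom_psiFibre, Bar.map_gauge, ← Bar.gauge_mul]
  refine Bar.gauge_congr _ fun i hi ↦ ?_
  have h := hs.map_sectionGauge_mul α (g.mapHom π) hi
  rw [← map_inv] at h
  exact h.symm

/-- The isomorphism `Ψ : BG ≅ BK ×_τ BL`. -/
noncomputable def psiIso (hex : IsShortExact ι π) (hs : IsPseudoCrossSection π s) :
    classifyingSpace G ≅
      twistedProduct (loopAction hex hs) (loopTwisting (classifyingSpace L)) :=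
  NatIso.ofComponents (fun Δ ↦ (psiEquiv hex hs Δ.unop.len).toIso) (by
    intro Δ Δ' f
    apply ConcreteCategory.hom_ext
    intro g
    exact Prod.ext (psiFibre_map hex hs f.unop g) (Bar.mapHom_map π f.unop g))

theorem mapHom_pairBar (hex : IsShortExact ι π) (hs : IsPseudoCrossSection π s) {n : ℕ}
    (k : Bar K n) (l : Bar L n) : (pairBar ι s k l).mapHom π = l := by
  funext i
  change π.app _ (ι.app _ (k i) * s i (l i)) = l i
  rw [map_mul, hs.proj]
  exact (congrArg (· * l i) (congrFun (hex.mapHom_mapHom k) i)).trans (one_mul _)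

theorem gauge_pairBar {n : ℕ} (k : Bar K n) (l : Bar L n) (i : Fin n) :
    (pairBar ι s k l).gauge (sectionGauge s l)⁻¹ i = psiEntry ι s k l i := by
  change (G.δ 0 (s (i + 1) (l.prod (i + 1) n))⁻¹)⁻¹ * (ι.app _ (k i) * s i (l i)) *
    (s i (l.prod i n))⁻¹ = _
  rw [map_inv, inv_inv, ← mul_assoc]
  rfl

theorem gauge_loopGauge {n : ℕ} (l : Bar L (n + 1)) (k : Bar K n) (i : Fin n) :
    (k.mapHom ι).gauge (loopGauge s l) i = actEntry ι s l k i := by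
  change (G.δ 0 (s (i + 1) (l.prod (i + 1) (n + 1)) * (s (i + 1) (l.prod (i + 1) n))⁻¹))⁻¹ *
    ι.app _ (k i) * (s i (l.prod i (n + 1)) * (s i (l.prod i n))⁻¹) = _
  rw [map_mul, map_inv, mul_inv_rev, inv_inv, ← mul_assoc]
  rfl

end Psi

end SimplicialBundle

theorem theorem1p1 {K G L : SimplicialObject GrpCat.{u}} (ι : K ⟶ G) (π : G ⟶ L)
    (hex : SimplicialBundle.IsShortExact ι π) :
    (∃ s : ∀ n : ℕ, L _⦋n⦌ → G _⦋n⦌,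
      SimplicialBundle.IsPseudoCrossSection π s ∧ ∀ n, s n 1 = 1) ∧
    (∀ s : ∀ n : ℕ, L _⦋n⦌ → G _⦋n⦌,
      SimplicialBundle.IsPseudoCrossSection π s → (∀ n, s n 1 = 1) →
      ∃ A : SimplicialBundle.SimplicialAction
          (SimplicialBundle.loopGroup (SimplicialBundle.classifyingSpace L))
          (SimplicialBundle.classifyingSpace K),
        (∀ (n : ℕ) (l : SimplicialBundle.Bar L (n + 1)) (k : SimplicialBundle.Bar K n)
          (i : Fin n),
          ι.app (op ⦋(i : ℕ)⦌)
            ((A.smul (op ⦋n⦌)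
              (SimplicialBundle.loopGen (SimplicialBundle.classifyingSpace L) n l) k :
              SimplicialBundle.Bar K n) i) = SimplicialBundle.actEntry ι s l k i) ∧
        ∃ Ψ : SimplicialBundle.classifyingSpace G ≅
            SimplicialBundle.twistedProduct A
              (SimplicialBundle.loopTwisting (SimplicialBundle.classifyingSpace L)),
          (∀ (n : ℕ) (k : SimplicialBundle.Bar K n) (l : SimplicialBundle.Bar L n),
            ∃ k' : SimplicialBundle.Bar K n,
              Ψ.hom.app (op ⦋n⦌) (SimplicialBundle.pairBar ι s k l) =
                ((k', l) : SimplicialBundle.Bar K n × SimplicialBundle.Bar L n) ∧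
              ∀ i : Fin n,
                ι.app (op ⦋(i : ℕ)⦌) (k' i) = SimplicialBundle.psiEntry ι s k l i) ∧
          Ψ.hom ≫ SimplicialBundle.twistedProductProj A
              (SimplicialBundle.loopTwisting (SimplicialBundle.classifyingSpace L)) =
            SimplicialBundle.classifyingSpaceMap π) ∧
    SimplicialBundle.IsFibreBundle (SimplicialBundle.classifyingSpaceMap π)
      (SimplicialBundle.classifyingSpace K)
      (SimplicialBundle.loopGroup (SimplicialBundle.classifyingSpace L)) := by
  have main : ∀ s : ∀ n : ℕ, L _⦋n⦌ → G _⦋n⦌,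
      ∀ hs : SimplicialBundle.IsPseudoCrossSection π s,
      (SimplicialBundle.psiIso hex hs).hom ≫ SimplicialBundle.twistedProductProj
        (SimplicialBundle.loopAction hex hs)
        (SimplicialBundle.loopTwisting (SimplicialBundle.classifyingSpace L)) =
      SimplicialBundle.classifyingSpaceMap π := fun s hs ↦ rfl
  obtain ⟨s, hs, hs1⟩ := SimplicialBundle.exists_isPseudoCrossSection π hex.surjective
  refine ⟨⟨s, hs, hs1⟩, fun t ht _ ↦ ⟨SimplicialBundle.loopAction hex ht, ?_,
    SimplicialBundle.psiIso hex ht, ?_, main t ht⟩, SimplicialBundle.loopAction hex hs, _,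
    SimplicialBundle.psiIso hex hs, main s hs⟩
  · intro n l k i
    exact (congrFun (SimplicialBundle.mapHom_loopAction_smul hex ht n l k) i).trans
      (SimplicialBundle.gauge_loopGauge l k i)
  · intro n k l
    have h := SimplicialBundle.mapHom_pairBar hex ht k l
    refine ⟨SimplicialBundle.psiFibre hex ht (SimplicialBundle.pairBar ι t k l),
      Prod.ext rfl h, fun i ↦ ?_⟩
    have hk := SimplicialBundle.mapHom_psiFibre hex ht (SimplicialBundle.pairBar ι t k l)
    rw [h] at hk
    exact (congrFun hk i).trans (SimplicialBundle.gauge_pairBar k l i)
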